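/- Let $(R,\mathfrak m)$ be a Noetherian local ring. For a sequence $\underline{x}=x_1,\dots,x_r$ of elements of $R$ let $$(\underline{x})^{\lim}=\bigcup_{n>0}\big((x_1^{n+1},\dots,x_r^{n+1}):(x_1\cdots x_r)^n\big)$$ be its limit closure. If $\underline{x}=x_1,\dots,x_r$ and $\underline{y}=y_1,\dots,y_r$ are sequences in $R$ and $A=(a_{ij})$ is an $r\times r$ matrix over $R$ with $y_i=\sum_j a_{ij}x_j$ for all $i$, write $(\underline{y})\overset{A}{\subseteq}(\underline{x})$; then $\det(A)\,(\underline{x})^{\lim}\subseteq(\underline{y})^{\lim}$, and the induced map $\det A: R/(\underline{x})^{\lim}\to R/(\underline{y})^{\lim}$, $a+(\underline{x})^{\lim}\mapsto \det(A)\,a+(\underline{y})^{\lim}$, is called the determinantal map. Let $U_R(0)=\bigcap_{\mathfrak p\in\operatorname{Ass}R,\ \dim R/\mathfrak p=\dim R}N(\mathfrak p)$, where $(0)=\bigcap_{\mathfrak p\in\operatorname{Ass}R}N(\mathfrak p)$ is a reduced primary decomposition of the zero ideal of $R$. **Theorem 5.1.** Suppose that $R/U_R(0)$ is Cohen–Macaulay.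 Let $\underline{x}=x_1,\dots,x_t$, $t=\dim R$, be a system of parameters of $R$, let $\underline{y}=y_1,\dots,y_t$ be a sequence of elements of $R$, and let $A$ be a $t\times t$ matrix over $R$ with $(\underline{y})\overset{A}{\subseteq}(\underline{x})$. Then $\underline{y}$ is a system of parameters of $R/U_R(0)$ if and only if the determinantal map $\det A: R/(\underline{x})^{\lim}\to R/(\underline{y})^{\lim}$ is injective. Moreover (corollary, Fouli–Huneke), without assuming that $R/U_R(0)$ is Cohen–Macaulay: if $\dim R=1$, $x$ is a parameter of $R$, and $y=ux$ with $u\in R$, then $y$ is a parameter of $R$ if and only if the map $R/(x)^{\lim}\overset{u}{\longrightarrow}R/(y)^{\lim}$ is injective. -/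

import Mathlib

open scoped Matrix

/-- The colon ideals whose union is the limit closure:
`(x₁ⁿ⁺¹, …, x_rⁿ⁺¹) : (x₁ ⋯ x_r)ⁿ`. -/
def limitColon {R : Type*} [CommRing R] {r : ℕ} (x : Fin r → R) (n : ℕ) : Ideal R :=
  (Ideal.span (Set.range fun i => x i ^ (n + 1))).colon {(∏ i, x i) ^ n}

theorem mem_limitColon {R : Type*} [CommRing R] {r : ℕ} {x : Fin r → R} {n : ℕ} {a : R} :
    a ∈ limitColon x n ↔
      a * (∏ i, x i) ^ n ∈ Ideal.span (Set.range fun i => x i ^ (n + 1)) := by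
  simp [limitColon, Submodule.mem_colon_singleton]

theorem mul_prod_pow_mem {R : Type*} [CommRing R] {r : ℕ} (x : Fin r → R) (m k : ℕ) {a : R}
    (ha : a ∈ Ideal.span (Set.range fun i => x i ^ m)) :
    a * (∏ i, x i) ^ k ∈ Ideal.span (Set.range fun i => x i ^ (m + k)) := by
  refine Submodule.span_induction
    (p := fun a _ => a * (∏ i, x i) ^ k ∈ Ideal.span (Set.range fun i => x i ^ (m + k)))
    ?_ ?_ ?_ ?_ ha
  · rintro _ ⟨i, rfl⟩
    obtain ⟨c, hc⟩ := Finset.dvd_prod_of_mem x (Finset.mem_univ i)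
    have : x i ^ m * (∏ i, x i) ^ k = c ^ k * x i ^ (m + k) := by rw [hc]; ring
    simp only [this]
    exact Ideal.mul_mem_left _ _ (Ideal.subset_span ⟨i, rfl⟩)
  · simp
  · intro a b _ _ h1 h2
    rw [add_mul]
    exact add_mem h1 h2
  · intro c a _ h
    rw [smul_eq_mul, mul_assoc]
    exact Ideal.mul_mem_left _ _ h

theorem limitColon_mono {R : Type*} [CommRing R] {r : ℕ} (x : Fin r → R) :
    Monotone (limitColon x) := by
  intro n m h a ha
  obtain ⟨k, rfl⟩ := Nat.exists_eq_add_of_le h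
  rw [mem_limitColon] at *
  have := mul_prod_pow_mem x (n + 1) k ha
  rw [mul_assoc, ← pow_add] at this
  convert this using 5
  ring

/-- The limit closure `(x)^lim = ⋃_{n > 0} ((x₁ⁿ⁺¹, …, x_rⁿ⁺¹) : (x₁ ⋯ x_r)ⁿ)` of a sequence
`x = x₁, …, x_r` in a commutative ring. -/
def limitClosure {R : Type*} [CommRing R] {r : ℕ} (x : Fin r → R) : Ideal R where
  carrier := ⋃ n > 0, (limitColon x n : Set R)
  zero_mem' := by
    simp only [Set.mem_iUnion]
    exact ⟨1, one_pos, zero_mem _⟩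
  add_mem' := by
    simp only [Set.mem_iUnion]
    rintro a b ⟨n, hn, ha⟩ ⟨m, _, hb⟩
    exact ⟨max n m, lt_max_of_lt_left hn,
      add_mem (limitColon_mono x (le_max_left n m) ha) (limitColon_mono x (le_max_right n m) hb)⟩
  smul_mem' := by
    simp only [Set.mem_iUnion]
    rintro c a ⟨n, hn, ha⟩
    exact ⟨n, hn, Ideal.mul_mem_left _ c ha⟩

theorem mem_limitClosure {R : Type*} [CommRing R] {r : ℕ} {x : Fin r → R} {a : R} :
    a ∈ limitClosure x ↔
      ∃ n > 0, a * (∏ i, x i) ^ n ∈ Ideal.span (Set.range fun i => x i ^ (n + 1)) := by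
  have : a ∈ limitClosure x ↔ a ∈ ⋃ n > 0, (limitColon x n : Set R) := Iff.rfl
  simp only [this, Set.mem_iUnion, SetLike.mem_coe, mem_limitColon, exists_prop]

theorem mulVec_mem_ideal {R : Type*} [CommRing R] {r : ℕ} (I : Ideal R) (x : Fin r → R)
    (A : Matrix (Fin r) (Fin r) R) (h : ∀ j, x j ∈ I) (i : Fin r) : (A *ᵥ x) i ∈ I := by
  change ∑ j, A i j * x j ∈ I
  exact Ideal.sum_mem I fun j _ => Ideal.mul_mem_left I _ (h j)

/-- Cramer's rule. -/
theorem det_mul_mem_span {R : Type*} [CommRing R] {r : ℕ} (x : Fin r → R)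
    (A : Matrix (Fin r) (Fin r) R) (i : Fin r) :
    A.det * x i ∈ Ideal.span (Set.range (A *ᵥ x)) := by
  have h : (A.adjugate *ᵥ (A *ᵥ x)) i = A.det * x i := by
    rw [Matrix.mulVec_mulVec, Matrix.adjugate_mul, Matrix.smul_mulVec, Matrix.one_mulVec]
    rfl
  rw [← h]
  exact mulVec_mem_ideal _ _ _ (fun j => Ideal.subset_span (Set.mem_range_self j)) i

theorem det_mul_mem_span_of_mem {R : Type*} [CommRing R] {r : ℕ} (x : Fin r → R)
    (A : Matrix (Fin r) (Fin r) R) {b : R} (hb : b ∈ Ideal.span (Set.range x)) :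
    A.det * b ∈ Ideal.span (Set.range (A *ᵥ x)) := by
  have : Ideal.span (Set.range x) ≤ Submodule.comap
      (LinearMap.mulLeft R A.det) (Ideal.span (Set.range (A *ᵥ x))) := by
    rw [Ideal.span_le]
    rintro _ ⟨i, rfl⟩
    exact det_mul_mem_span x A i
  exact this hb

/-- Two matrices with the same product with `x` that differ in only one row. -/
theorem det_updateRow_sub_mul_prod_mem {R : Type*} [CommRing R] {r : ℕ} (x z : Fin r → R)
    (C : Matrix (Fin r) (Fin r) R) (i : Fin r) (v : Fin r → R)
    (hv : v ⬝ᵥ x = 0) (hC : ∀ j ≠ i, (C *ᵥ x) j = z j)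
    (hz : z i ∈ Ideal.span (Set.range x)) :
    (C.updateRow i v).det * (∏ j, z j) ∈ Ideal.span (Set.range fun j => z j ^ 2) := by
  have hM : ∀ j, ((C.updateRow i v) *ᵥ x) j = if j = i then 0 else z j := by
    intro j
    split_ifs with h
    · subst h; simpa [Matrix.mulVec] using hv
    · rw [← hC j h]; simp [Matrix.mulVec, h]
  have h1 := det_mul_mem_span_of_mem x (C.updateRow i v) hz
  rw [← Finset.mul_prod_erase _ _ (Finset.mem_univ i), ← mul_assoc]
  set P := ∏ j ∈ Finset.univ.erase i, z j with hP
  have h2 : Ideal.span (Set.range ((C.updateRow i v) *ᵥ x)) ≤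
      Submodule.comap (LinearMap.mulRight R P)
        (Ideal.span (Set.range fun j => z j ^ 2)) := by
    rw [Ideal.span_le]
    rintro _ ⟨j, rfl⟩
    simp only [SetLike.mem_coe, Submodule.mem_comap, LinearMap.mulRight_apply, hM]
    split_ifs with h
    · simp
    · obtain ⟨c, hc⟩ := Finset.dvd_prod_of_mem z
        (Finset.mem_erase.2 ⟨h, Finset.mem_univ j⟩)
      rw [hP, hc]
      have : z j * (z j * c) = c * z j ^ 2 := by ring
      rw [this]
      exact Ideal.mul_mem_left _ _ (Ideal.subset_span ⟨j, rfl⟩)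
  exact h2 h1

theorem det_sub_det_mul_prod_mem {R : Type*} [CommRing R] {r : ℕ} (x z : Fin r → R)
    (C D : Matrix (Fin r) (Fin r) R) (hC : z = C *ᵥ x) (hD : z = D *ᵥ x) :
    (C.det - D.det) * (∏ j, z j) ∈ Ideal.span (Set.range fun j => z j ^ 2) := by
  have hz : ∀ i, z i ∈ Ideal.span (Set.range x) := by
    intro i
    rw [hC]
    exact mulVec_mem_ideal _ _ _ (fun j => Ideal.subset_span (Set.mem_range_self j)) i
  -- replace the rows of `C` by those of `D` one at a time
  have key : ∀ s : Finset (Fin r),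
      (C.det - (Matrix.of fun i => if i ∈ s then D i else C i).det) * (∏ j, z j) ∈
        Ideal.span (Set.range fun j => z j ^ 2) := by
    intro s
    induction s using Finset.induction_on with
    | empty =>
      have : (Matrix.of fun i => if i ∈ (∅ : Finset (Fin r)) then D i else C i) = C := by
        ext; simp
      rw [this]; simp
    | insert i s his ih =>
      set E : Matrix (Fin r) (Fin r) R := Matrix.of fun j => if j ∈ s then D j else C j with hE
      have hEx : ∀ j, (E *ᵥ x) j = z j := by
        intro j
        by_cases h : j ∈ s
        · rw [hD]; simp [hE, Matrix.mulVec, h]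
        · rw [hC]; simp [hE, Matrix.mulVec, h]
      have hE1 : E.updateRow i (C i) = E := by
        ext j k
        by_cases h : j = i
        · subst h; simp [hE, his]
        · simp [h]
      have hE2 : (Matrix.of fun j => if j ∈ insert i s then D j else C j) =
          E.updateRow i (D i) := by
        ext j k
        by_cases h : j = i
        · subst h; simp
        · simp [hE, h, Matrix.updateRow_ne]
      have hd : E.det = (E.updateRow i (C i - D i)).det + (E.updateRow i (D i)).det := by
        rw [← Matrix.det_updateRow_add, sub_add_cancel, hE1]
      have hv : (C i - D i) ⬝ᵥ x = 0 := by
        have h1 := congrFun hC i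
        have h2 := congrFun hD i
        simp only [Matrix.mulVec] at h1 h2
        rw [sub_dotProduct, ← h1]
        rw [sub_eq_zero]
        exact h2
      have h3 := det_updateRow_sub_mul_prod_mem x z E i (C i - D i) hv (fun j _ => hEx j) (hz i)
      rw [hE2]
      have : (C.det - (E.updateRow i (D i)).det) * ∏ j, z j =
          (C.det - E.det) * ∏ j, z j + (E.updateRow i (C i - D i)).det * ∏ j, z j := by
        rw [hd]; ring
      rw [this]
      exact add_mem ih h3
  have h := key Finset.univ
  have hD' : (Matrix.of fun i => if i ∈ Finset.univ then D i else C i) = D := by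
    ext; simp
  rwa [hD'] at h

theorem exists_mulVec_of_mem_span {R : Type*} [CommRing R] {r : ℕ} (x z : Fin r → R)
    (h : ∀ i, z i ∈ Ideal.span (Set.range x)) :
    ∃ B : Matrix (Fin r) (Fin r) R, z = B *ᵥ x := by
  have : ∀ i, ∃ c : Fin r → R, ∑ j, c j * x j = z i := fun i =>
    Ideal.mem_span_range_iff_exists_fun.1 (h i)
  choose B hB using this
  exact ⟨Matrix.of B, funext fun i => (hB i).symm⟩

/-- Multiplication by `det A` maps `(x)^lim` into `(y)^lim` when `y = A x`. -/
theorem limitClosure_le_comap {R : Type*} [CommRing R] {r : ℕ} (x y : Fin r → R)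
    (A : Matrix (Fin r) (Fin r) R) (h : y = A *ᵥ x) :
    limitClosure x ≤ Submodule.comap (LinearMap.mulLeft R A.det) (limitClosure y) := by
  intro a ha
  obtain ⟨n, -, ha⟩ := mem_limitClosure.1 ha
  rw [Submodule.mem_comap, LinearMap.mulLeft_apply, mem_limitClosure]
  set I := Ideal.span (Set.range fun i => x i ^ (n + 1)) with hI
  -- a power of each `y i` lies in the ideal of the powers of the `x j`
  have hy : ∀ i, y i ∈ I.radical := by
    intro i
    rw [h]
    refine mulVec_mem_ideal _ _ _ (fun j => ?_) i
    exact ⟨n + 1, Ideal.subset_span ⟨j, rfl⟩⟩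
  choose N hN using hy
  set m := ∑ i, N i with hm
  have hz : ∀ i, y i ^ (m + 1) ∈ I := by
    intro i
    have : N i ≤ m + 1 :=
      (Finset.single_le_sum (f := N) (fun _ _ => Nat.zero_le _) (Finset.mem_univ i)).trans
        (Nat.le_succ _)
    exact Ideal.mem_of_dvd _ (pow_dvd_pow _ this) (hN i)
  obtain ⟨B, hB⟩ := exists_mulVec_of_mem_span (fun i => x i ^ (n + 1)) (fun i => y i ^ (m + 1)) hz
  have h1 : (fun i => y i ^ (m + 1)) = (Matrix.diagonal (fun i => y i ^ m) * A) *ᵥ x := by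
    rw [← Matrix.mulVec_mulVec, ← h]
    ext i
    rw [Matrix.mulVec_diagonal, pow_succ]
  have h2 : (fun i => y i ^ (m + 1)) = (B * Matrix.diagonal (fun i => x i ^ n)) *ᵥ x := by
    rw [← Matrix.mulVec_mulVec]
    refine hB.trans ?_
    congr 1
    ext i
    rw [Matrix.mulVec_diagonal, pow_succ]
  have h3 := det_sub_det_mul_prod_mem x _ _ _ h1 h2
  simp only [Matrix.det_mul, Matrix.det_diagonal, Finset.prod_pow] at h3
  have h4 : B.det * (a * (∏ i, x i) ^ n) ∈ Ideal.span (Set.range fun i => y i ^ (m + 1)) := by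
    rw [hB]
    exact det_mul_mem_span_of_mem _ B ha
  have h5 := mul_prod_pow_mem y (m + 1) (m + 1) h4
  have e : (fun j => (y j ^ (m + 1)) ^ 2) = fun i => y i ^ (m + 1 + (m + 1)) := by
    ext j; ring
  rw [e] at h3
  refine ⟨2 * m + 1, by omega, ?_⟩
  have h6 := add_mem (Ideal.mul_mem_left _ a h3) h5
  have e2 : 2 * m + 1 + 1 = m + 1 + (m + 1) := by ring
  rw [e2]
  convert h6 using 1
  ring

/-- The determinantal map `det A : R/(x)^lim → R/(y)^lim`,
`a + (x)^lim ↦ det A * a + (y)^lim`, for sequences with `y = A x`. -/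
def determinantalMap {R : Type*} [CommRing R] {r : ℕ} (x y : Fin r → R)
    (A : Matrix (Fin r) (Fin r) R) (h : y = A *ᵥ x) :
    (R ⧸ limitClosure x) →ₗ[R] (R ⧸ limitClosure y) :=
  Submodule.mapQ (limitClosure x) (limitClosure y) (LinearMap.mulLeft R A.det)
    (limitClosure_le_comap x y A h)

/-- `x = x₁, …, x_t` is a system of parameters of the finitely generated module `M` over a
Noetherian local ring: `t = dim M`, the `x_i` are in the maximal ideal, and `M/xM` has finite
length. -/
structure IsSystemOfParameters {R : Type*} [CommRing R] [IsLocalRing R]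
    (M : Type*) [AddCommGroup M] [Module R M] {t : ℕ} (x : Fin t → R) : Prop where
  dim_eq : Module.supportDim R M = t
  mem_maximalIdeal : ∀ i, x i ∈ IsLocalRing.maximalIdeal R
  finiteLength : IsFiniteLength R (M ⧸ (Ideal.span (Set.range x) • ⊤ : Submodule R M))

/-- A finitely generated module `M` over a Noetherian local ring is Cohen–Macaulay if it is zero or
if its depth is its dimension, i.e. there is an `M`-regular sequence of length `dim M` in the
maximal ideal (no regular sequence is longer). A quotient ring `R/I` is a Cohen–Macaulay ring if
and only if it is a Cohen–Macaulay `R`-module. -/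
def IsCohenMacaulayModule (R : Type*) [CommRing R] [IsLocalRing R]
    (M : Type*) [AddCommGroup M] [Module R M] : Prop :=
  Subsingleton M ∨ ∃ s : List R, (∀ a ∈ s, a ∈ IsLocalRing.maximalIdeal R) ∧
    RingTheory.Sequence.IsRegular M s ∧ Module.supportDim R M = s.length

/-- The intersection of those components `q` of a primary decomposition for which
`dim R/√q = dim R`. -/
noncomputable def topDimensionalPart {R : Type*} [CommRing R] (T : Finset (Ideal R)) : Ideal R :=
  ⨅ q ∈ T, ⨅ _ : ringKrullDim (R ⧸ q.radical) = ringKrullDim R, q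

theorem exists_reducedPrimaryDecomposition (R : Type*) [CommRing R] [IsNoetherianRing R] :
    ∃ T : Finset (Ideal R), Submodule.IsMinimalPrimaryDecomposition (⊥ : Ideal R) T :=
  Submodule.IsLasker.exists_isMinimalPrimaryDecomposition (Submodule.isLasker R R) ⊥

theorem topDimensionalPart_eq {R : Type*} [CommRing R] {T T' : Finset (Ideal R)}
    (hT : Submodule.IsMinimalPrimaryDecomposition (⊥ : Ideal R) T)
    (hT' : Submodule.IsMinimalPrimaryDecomposition (⊥ : Ideal R) T') :
    topDimensionalPart T = topDimensionalPart T' := by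
  classical
  have hfin : (Submodule.associatedPrimes (⊥ : Ideal R)).Finite := by
    rw [← hT.image_radical_eq_associated_primes]
    exact T.finite_toSet.image _
  have := hfin.fintype
  let s₀ : Finset (Submodule.associatedPrimes (⊥ : Ideal R)) :=
    Finset.univ.filter fun p => ringKrullDim (R ⧸ p.1) = ringKrullDim R
  have hs₀ : IsLowerSet (s₀ : Set (Submodule.associatedPrimes (⊥ : Ideal R))) := by
    intro p q hqp hp
    simp only [s₀, Finset.coe_filter, Finset.mem_univ, true_and, Set.mem_ofPred_eq] at hp ⊢
    refine le_antisymm (ringKrullDim_quotient_le _) ?_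
    rw [← hp]
    exact ringKrullDim_le_of_surjective (Ideal.Quotient.factor (show q.1 ≤ p.1 from hqp))
      (Ideal.Quotient.factor_surjective _)
  have main : ∀ {T : Finset (Ideal R)},
      Submodule.IsMinimalPrimaryDecomposition (⊥ : Ideal R) T →
      topDimensionalPart T = _ := fun {T} hT => by
    let s := T.filter fun q => ringKrullDim (R ⧸ q.radical) = ringKrullDim R
    have hs' : (s.image fun q => (q.colon Set.univ).radical) = s₀.image (↑) := by
      ext p
      have h := Set.ext_iff.1 hT.image_radical_eq_associated_primes p
      simp only [Set.mem_image, Finset.mem_coe, Submodule.colon_univ] at h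
      simp only [s, s₀, Finset.mem_image, Finset.mem_filter, Finset.mem_univ, true_and,
        Submodule.colon_univ, Subtype.exists]
      constructor
      · rintro ⟨q, ⟨hq, hd⟩, rfl⟩
        exact ⟨q.radical, h.1 ⟨q, hq, rfl⟩, hd, rfl⟩
      · rintro ⟨p', hp', hd, rfl⟩
        obtain ⟨q, hq, rfl⟩ := h.2 hp'
        exact ⟨q, ⟨hq, hd⟩, rfl⟩
    have h := hT.comap_localized₀_eq_iInf s₀ hs₀ s (Finset.filter_subset _ _) hs'
    refine Eq.trans ?_ h.symm
    simp only [topDimensionalPart, s, Finset.mem_filter, iInf_and]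
  exact (main hT).trans (main hT').symm

/-- The unmixed component `U_R(0)` of a Noetherian ring: the intersection of the components `N(p)`
with `dim R/p = dim R` in a reduced primary decomposition of `(0)`. -/
noncomputable def unmixedComponent (R : Type*) [CommRing R] [IsNoetherianRing R] : Ideal R :=
  topDimensionalPart (exists_reducedPrimaryDecomposition R).choose

/-- `U_R(0)` does not depend on the reduced primary decomposition. -/
theorem unmixedComponent_eq (R : Type*) [CommRing R] [IsNoetherianRing R]
    {T : Finset (Ideal R)} (hT : Submodule.IsMinimalPrimaryDecomposition (⊥ : Ideal R) T) :
    unmixedComponent R = topDimensionalPart T :=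
  topDimensionalPart_eq (exists_reducedPrimaryDecomposition R).choose_spec hT

theorem singleton_eq_mulVec {R : Type*} [CommRing R] (u x : R) :
    ![u * x] = !![u] *ᵥ ![x] := by
  ext i
  fin_cases i
  simp [mul_comm]

/-! Write U for the unmixed component. If u lies in U, then R/ann(u) has dimension less than t = dim
R. In a local ring of dimension less than t, the limit closure of t elements of the maximal ideal is
the whole ring, so U lies in every such limit closure over R. Limit closures can therefore be
computed in R/U (`mk_mem_limitClosure_iff_mem`), a ring of dimension t, and of depth t under the
Cohen–Macaulay hypothesis.

If y is a system of parameters there, then high powers of the x_i are B y for some matrix B. Both B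
A and a diagonal matrix send x to these powers. Two matrices with the same effect on x have equal
determinants modulo the limit closure of the target, and the diagonal determinant acts injectively,
so det A does too (`mem_limitClosure_of_det_mul_mem`). This direction needs no depth.

For the converse (`DepthAtLeast.maximalIdeal_le_radical_of_injective`), choose generic elements z_0,
z_1, … of I = (y). If the first t of them form a regular sequence, I is primary to the maximal
ideal. Otherwise there is a first g < t with I inside an associated prime ((z_0, …, z_{g-1}) : b).
Complete z_0, …, z_{g-1} to a regular system of parameters v with b outside (v). Raising the
remaining z's to a power gives z' inside (v) with the same radical as I, so injectivity for x → y
yields injectivity for x → z'. A socle argument transfers it to v → z'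
(`IsPermutableRegular.mem_span_of_det_mul_mem`). But b z_g lies in (z_0, …, z_{g-1}), so b is in the
limit closure of z', which forces b into (v): a contradiction.

In dimension one, R/U always has depth at least one and U is nil, so the corollary is the same
equivalence with U removed. -/

/-! ### Regular sequences modulo an ideal: powers, colons and socles. -/

/-- Multiplication by `s` is injective on `R ⧸ J`. -/
def IsRegularMod {R : Type*} [CommRing R] (J : Ideal R) (s : R) : Prop :=
  ∀ a, s * a ∈ J → a ∈ J

/-- `l` is a weakly regular sequence on `R ⧸ J`. -/
def IsRegularSeqMod {R : Type*} [CommRing R] : Ideal R → List R → Prop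
  | _, [] => True
  | J, s :: l => IsRegularMod J s ∧ IsRegularSeqMod (J ⊔ Ideal.span {s}) l

section

variable {R : Type*} [CommRing R]

theorem Ideal.mem_sup_span_singleton_iff {J : Ideal R} {a c : R} :
    c ∈ J ⊔ Ideal.span {a} ↔ ∃ d, c - a * d ∈ J := by
  rw [Submodule.mem_sup]
  constructor
  · rintro ⟨j, hj, e, he, rfl⟩
    obtain ⟨d, rfl⟩ := Ideal.mem_span_singleton'.1 he
    exact ⟨d, by convert hj using 1; ring⟩
  · rintro ⟨d, hd⟩
    exact ⟨_, hd, a * d, Ideal.mul_mem_right _ _ (Ideal.mem_span_singleton_self a), by ring⟩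

theorem IsRegularMod.pow {J : Ideal R} {s : R} (h : IsRegularMod J s) (n : ℕ) :
    IsRegularMod J (s ^ n) := by
  induction n with
  | zero => intro a ha; simpa using ha
  | succ n ih =>
    intro a ha
    exact h a (ih _ (by rwa [pow_succ, mul_assoc] at ha))

/-- From a c ≡ b d modulo J, regularity of b gives d ≡ a e modulo J + (a), and then a can be
cancelled. Unlike `IsRegularMod.of_sup_span`, this half of exchanging a and b needs no local
hypothesis. -/
theorem IsRegularMod.sup_span_swap {J : Ideal R} {a b : R} (ha : IsRegularMod J a)
    (hb : IsRegularMod (J ⊔ Ideal.span {a}) b) : IsRegularMod (J ⊔ Ideal.span {b}) a := by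
  intro c hc
  obtain ⟨d, hd⟩ := Ideal.mem_sup_span_singleton_iff.1 hc
  have h1 : b * d ∈ J ⊔ Ideal.span {a} := by
    refine Ideal.mem_sup_span_singleton_iff.2 ⟨c, ?_⟩
    rw [← neg_mem_iff]
    convert hd using 1
    ring
  obtain ⟨e, he⟩ := Ideal.mem_sup_span_singleton_iff.1 (hb d h1)
  refine Ideal.mem_sup_span_singleton_iff.2 ⟨e, ha _ ?_⟩
  convert add_mem hd (Ideal.mul_mem_left _ b he) using 1
  ring

theorem IsRegularSeqMod.append {l l' : List R} {J : Ideal R} :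
    IsRegularSeqMod J (l ++ l') ↔
      IsRegularSeqMod J l ∧ IsRegularSeqMod (J ⊔ Ideal.ofList l) l' := by
  induction l generalizing J with
  | nil => simp [IsRegularSeqMod]
  | cons s l ih => simp [IsRegularSeqMod, ih, and_assoc, sup_assoc]

/-- A family of elements that is a regular sequence in every order. -/
def IsPermutableRegular {ι : Type*} (v : ι → R) : Prop :=
  ∀ (T : Finset ι), ∀ i ∉ T, IsRegularMod (Ideal.span (v '' T)) (v i)

theorem IsRegularMod.sup_span_pow {K : Ideal R} {a b : R} (ha : IsRegularMod K a)
    (hab : IsRegularMod (K ⊔ Ideal.span {a}) b) (n : ℕ) :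
    IsRegularMod (K ⊔ Ideal.span {a ^ n}) b := by
  induction n with
  | zero =>
    intro c _
    simp
  | succ n ih =>
    intro c hc
    obtain ⟨e, he⟩ := Ideal.mem_sup_span_singleton_iff.1 hc
    have h1 : b * c ∈ K ⊔ Ideal.span {a ^ n} :=
      Ideal.mem_sup_span_singleton_iff.2 ⟨a * e, by convert he using 1; ring⟩
    obtain ⟨d, hd⟩ := Ideal.mem_sup_span_singleton_iff.1 (ih c h1)
    have h2 : a ^ n * (b * d - a * e) ∈ K := by
      convert sub_mem he (Ideal.mul_mem_left _ b hd) using 1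
      ring
    have h3 := hab d (Ideal.mem_sup_span_singleton_iff.2 ⟨e, ha.pow n _ h2⟩)
    obtain ⟨f, hf⟩ := Ideal.mem_sup_span_singleton_iff.1 h3
    refine Ideal.mem_sup_span_singleton_iff.2 ⟨f, ?_⟩
    convert add_mem hd (Ideal.mul_mem_left _ (a ^ n) hf) using 1
    ring

theorem Ideal.span_image_insert {ι : Type*} [DecidableEq ι] (v : ι → R) (T : Finset ι) (i : ι) :
    Ideal.span (v '' (insert i T : Finset ι)) = Ideal.span (v '' T) ⊔ Ideal.span {v i} := by
  rw [Finset.coe_insert, Set.image_insert_eq, Ideal.span_insert, sup_comm]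

theorem Ideal.span_image_update_of_notMem {ι : Type*} [DecidableEq ι] (v : ι → R) {T : Finset ι}
    {i : ι} (hi : i ∉ T) (a : R) :
    Ideal.span (Function.update v i a '' T) = Ideal.span (v '' T) := by
  congr 1
  refine Set.image_congr fun j hj => Function.update_of_ne ?_ _ _
  rintro rfl
  exact hi hj

theorem IsPermutableRegular.update_pow {ι : Type*} [DecidableEq ι] {v : ι → R}
    (hv : IsPermutableRegular v) (i : ι) (n : ℕ) :
    IsPermutableRegular (Function.update v i (v i ^ n)) := by
  intro T j hj
  by_cases hi : i ∈ T
  · have hji : j ≠ i := by rintro rfl; exact hj hi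
    obtain ⟨T', hi', rfl⟩ : ∃ T', i ∉ T' ∧ insert i T' = T :=
      ⟨T.erase i, Finset.notMem_erase i T, Finset.insert_erase hi⟩
    have h1 := hv T' i hi'
    have h2 := hv _ j hj
    rw [Ideal.span_image_insert] at h2 ⊢
    rw [Ideal.span_image_update_of_notMem v hi', Function.update_self, Function.update_of_ne hji]
    exact h1.sup_span_pow h2 n
  · rw [Ideal.span_image_update_of_notMem v hi]
    by_cases hji : j = i
    · subst hji
      rw [Function.update_self]
      exact (hv T j hj).pow n
    · rw [Function.update_of_ne hji]
      exact hv T j hj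

theorem IsPermutableRegular.pow {ι : Type*} [Fintype ι] {v : ι → R}
    (hv : IsPermutableRegular v) (e : ι → ℕ) : IsPermutableRegular fun i => v i ^ e i := by
  classical
  have key : ∀ T : Finset ι, IsPermutableRegular fun i => if i ∈ T then v i ^ e i else v i := by
    intro T
    induction T using Finset.induction_on with
    | empty => simpa using hv
    | insert i T hi ih =>
      convert ih.update_pow i (e i) using 1
      ext j
      by_cases hj : j = i
      · subst hj; simp [hi]
      · simp [hj]
  simpa using key Finset.univ

theorem Ideal.span_range_eq_sup_erase {ι : Type*} [Fintype ι] [DecidableEq ι] (w : ι → R) (i : ι) :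
    Ideal.span (Set.range w) =
      Ideal.span (w '' (Finset.univ.erase i : Finset ι)) ⊔ Ideal.span {w i} := by
  rw [← Ideal.span_image_insert, Finset.insert_erase (Finset.mem_univ i), Finset.coe_univ,
    Set.image_univ]

/-- The variables are cancelled one at a time: modulo the other generators v_i^n is regular, so
dividing by it lowers the exponent of v_i from n + 1 to 1. With T everything, this says that the
limit closure is no larger than the ideal itself. -/
theorem IsPermutableRegular.mem_span_of_mul_prod_mem {ι : Type*} [Fintype ι] [DecidableEq ι]
    {v : ι → R} (hv : IsPermutableRegular v) (n : ℕ) (T : Finset ι) {a : R}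
    (ha : a * (∏ i ∈ T, v i) ^ n ∈ Ideal.span (Set.range fun i => v i ^ (n + 1))) :
    a ∈ Ideal.span (Set.range fun i => v i ^ (if i ∈ T then 1 else n + 1)) := by
  induction T using Finset.induction_on generalizing a with
  | empty => simpa using ha
  | insert i T hi ih =>
    set w : ι → R := fun j => v j ^ (if j ∈ insert i T then 1 else n + 1) with hw
    set u : ι → R := fun j => v j ^ (if j ∈ T then 1 else n + 1) with hu
    have h1 : (v i ^ n) * a ∈ Ideal.span (Set.range u) := by
      refine ih ?_
      convert ha using 1
      rw [Finset.prod_insert hi]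
      ring
    rw [Ideal.span_range_eq_sup_erase u i] at h1
    rw [Ideal.span_range_eq_sup_erase w i]
    have e1 : u '' (Finset.univ.erase i : Finset ι) = w '' (Finset.univ.erase i : Finset ι) := by
      refine Set.image_congr fun j hj => ?_
      have hj : j ≠ i := by simpa using hj
      simp [hu, hw, hj]
    have e2 : u i = v i ^ n * v i := by simp [hu, hi, pow_succ]
    have e3 : w i = v i := by simp [hw]
    rw [e1, e2] at h1
    rw [e3]
    obtain ⟨d, hd⟩ := Ideal.mem_sup_span_singleton_iff.1 h1
    refine Ideal.mem_sup_span_singleton_iff.2 ⟨d, ?_⟩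
    -- The exponent family is rigged so that the entry at i is the element to cancel and the other
    -- entries are the generators of w.
    have hreg := hv.pow (fun j => if j = i then n else if j ∈ insert i T then 1 else n + 1)
      (Finset.univ.erase i) i (Finset.notMem_erase i _)
    have e4 : (fun j => v j ^ (if j = i then n else if j ∈ insert i T then 1 else n + 1)) ''
        (Finset.univ.erase i : Finset ι) = w '' (Finset.univ.erase i : Finset ι) := by
      refine Set.image_congr fun j hj => ?_
      have hj : j ≠ i := by simpa using hj
      simp [hw, hj]
    rw [e4] at hreg
    simp only [if_true] at hreg
    refine hreg _ ?_
    convert hd using 1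
    ring

/-- The socle elements modulo the powers of a regular sequence. -/
theorem IsPermutableRegular.exists_sub_mul_prod_mem {ι : Type*} [Fintype ι]
    {v : ι → R} (hv : IsPermutableRegular v) (n : ℕ) {b : R}
    (hb : ∀ i, v i * b ∈ Ideal.span (Set.range fun i => v i ^ (n + 1))) :
    ∃ c, b - c * (∏ i, v i) ^ n ∈ Ideal.span (Set.range fun i => v i ^ (n + 1)) := by
  classical
  -- The factors v_i^n are extracted one at a time. Being killed by v_i modulo the powers forces the
  -- current coefficient to be divisible by v_i^n, up to terms that the remaining product absorbs.
  have key : ∀ T : Finset ι, ∃ c, b - c * (∏ i ∈ T, v i) ^ n ∈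
      Ideal.span (Set.range fun i => v i ^ (n + 1)) := by
    intro T
    induction T using Finset.induction_on with
    | empty => exact ⟨b, by simp⟩
    | insert i T hi ih =>
      obtain ⟨c, hc⟩ := ih
      have h1 : (v i * c) * (∏ i ∈ T, v i) ^ n ∈
          Ideal.span (Set.range fun i => v i ^ (n + 1)) := by
        convert sub_mem (hb i) (Ideal.mul_mem_left _ (v i) hc) using 1
        ring
      have h2 := hv.mem_span_of_mul_prod_mem n T h1
      set u : ι → R := fun j => v j ^ (if j ∈ T then 1 else n + 1) with hu
      rw [Ideal.span_range_eq_sup_erase u i] at h2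
      obtain ⟨d, hd⟩ := Ideal.mem_sup_span_singleton_iff.1 h2
      have e2 : u i = v i * v i ^ n := by simp [hu, hi, pow_succ']
      have hreg := hv.pow (fun j => if j = i then 1 else if j ∈ T then 1 else n + 1)
        (Finset.univ.erase i) i (Finset.notMem_erase i _)
      have e4 : (fun j => v j ^ (if j = i then 1 else if j ∈ T then 1 else n + 1)) ''
          (Finset.univ.erase i : Finset ι) = u '' (Finset.univ.erase i : Finset ι) := by
        refine Set.image_congr fun j hj => ?_
        have hj : j ≠ i := by simpa using hj
        simp [hu, hj]
      rw [e4] at hreg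
      simp only [if_true, pow_one] at hreg
      have h3 : c - v i ^ n * d ∈ Ideal.span (u '' (Finset.univ.erase i : Finset ι)) := by
        refine hreg _ ?_
        convert hd using 1
        rw [e2]; ring
      have h4 : (c - v i ^ n * d) * (∏ i ∈ T, v i) ^ n ∈
          Ideal.span (Set.range fun i => v i ^ (n + 1)) := by
        have : Ideal.span (u '' (Finset.univ.erase i : Finset ι)) ≤
            Submodule.comap (LinearMap.mulRight R ((∏ i ∈ T, v i) ^ n))
              (Ideal.span (Set.range fun i => v i ^ (n + 1))) := by
          rw [Ideal.span_le]
          rintro _ ⟨j, -, rfl⟩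
          simp only [SetLike.mem_coe, Submodule.mem_comap, LinearMap.mulRight_apply, hu]
          split_ifs with hj
          · obtain ⟨p, hp⟩ := Finset.dvd_prod_of_mem v hj
            have : v j ^ 1 * (∏ i ∈ T, v i) ^ n = p ^ n * v j ^ (n + 1) := by rw [hp]; ring
            rw [this]
            exact Ideal.mul_mem_left _ _ (Ideal.subset_span ⟨j, rfl⟩)
          · exact Ideal.mul_mem_right _ _ (Ideal.subset_span ⟨j, rfl⟩)
        exact this h3
      refine ⟨d, ?_⟩
      rw [Finset.prod_insert hi]
      convert add_mem hc h4 using 1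
      ring
  exact key Finset.univ

theorem IsPermutableRegular.limitClosure_le {r : ℕ} {v : Fin r → R} (hv : IsPermutableRegular v) :
    limitClosure v ≤ Ideal.span (Set.range v) := by
  intro a ha
  obtain ⟨n, -, ha⟩ := mem_limitClosure.1 ha
  simpa using hv.mem_span_of_mul_prod_mem n Finset.univ ha

end

/-! ### Reordering regular sequences in a local ring. -/

section

variable {R : Type*} [CommRing R] [IsLocalRing R] [IsNoetherianRing R]

open IsLocalRing

/-- Nakayama: the colon K = (J : b) satisfies K ⊆ J + a K, hence K ⊆ J. -/
theorem IsRegularMod.of_sup_span {J : Ideal R} {a b : R} (ham : a ∈ maximalIdeal R)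
    (ha : IsRegularMod J a) (hb : IsRegularMod (J ⊔ Ideal.span {a}) b) : IsRegularMod J b := by
  let K : Ideal R := J.colon {b}
  have hK : ∀ c, c ∈ K ↔ b * c ∈ J := fun c => by
    rw [Submodule.mem_colon_singleton, smul_eq_mul, mul_comm]
  have hle : K ≤ J ⊔ maximalIdeal R • K := by
    intro c hc
    rw [hK] at hc
    obtain ⟨d, hd⟩ := Ideal.mem_sup_span_singleton_iff.1 (hb c (Ideal.mem_sup_left hc))
    have hdK : d ∈ K := by
      rw [hK]
      refine ha _ ?_
      convert sub_mem hc (Ideal.mul_mem_left _ b hd) using 1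
      ring
    have : c = (c - a * d) + a * d := by ring
    rw [this]
    exact add_mem (Ideal.mem_sup_left hd) (Ideal.mem_sup_right (Submodule.smul_mem_smul ham hdK))
  have := Submodule.le_of_le_smul_of_le_jacobson_bot (IsNoetherian.noetherian K)
    (maximalIdeal_le_jacobson ⊥) hle
  intro c hc
  exact this ((hK c).2 hc)

theorem IsRegularSeqMod.perm {l l' : List R} (hp : l.Perm l') {J : Ideal R}
    (hl : ∀ a ∈ l, a ∈ maximalIdeal R) (h : IsRegularSeqMod J l) : IsRegularSeqMod J l' := by
  induction hp generalizing J with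
  | nil => exact h
  | cons a _ ih => exact ⟨h.1, ih (fun b hb => hl b (List.mem_cons_of_mem _ hb)) h.2⟩
  | swap a b l =>
    obtain ⟨h1, h2, h3⟩ := h
    refine ⟨h1.of_sup_span (hl _ (by simp)) h2, h1.sup_span_swap h2, ?_⟩
    rwa [sup_assoc, sup_comm (Ideal.span {a}), ← sup_assoc]
  | trans h1 h2 ih1 ih2 => exact ih2 (fun b hb => hl b (h1.mem_iff.2 hb)) (ih1 hl h)

theorem IsRegularSeqMod.isPermutableRegular {r : ℕ} {v : Fin r → R}
    (hv : ∀ i, v i ∈ maximalIdeal R) (h : IsRegularSeqMod ⊥ (List.ofFn v)) :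
    IsPermutableRegular v := by
  intro T i hi
  classical
  -- Reorder so that T comes first and i immediately after it.
  have hp : (List.finRange r).Perm (T.toList ++ i :: (Finset.univ \ insert i T).toList) := by
    rw [List.perm_ext_iff_of_nodup (List.nodup_finRange r)]
    · intro j
      simp only [List.mem_finRange, List.mem_append, Finset.mem_toList, List.mem_cons,
        Finset.mem_sdiff, Finset.mem_univ, Finset.mem_insert, true_and, true_iff]
      tauto
    · refine List.Nodup.append (Finset.nodup_toList T) ?_ ?_
      · simp [Finset.nodup_toList]
      · intro j hj hj'
        simp only [Finset.mem_toList, List.mem_cons, Finset.mem_sdiff, Finset.mem_univ,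
          Finset.mem_insert, true_and] at hj hj'
        rcases hj' with rfl | hj'
        · exact hi hj
        · exact hj' (Or.inr hj)
  have hp' := hp.map v
  rw [← List.ofFn_eq_map] at hp'
  have h1 := h.perm hp' (fun a ha => by obtain ⟨j, rfl⟩ := (List.mem_ofFn' v a).1 ha; exact hv j)
  rw [List.map_append, IsRegularSeqMod.append] at h1
  have h2 := h1.2.1
  have e : Ideal.ofList (T.toList.map v) = Ideal.span (v '' T) := by
    rw [Ideal.ofList]
    congr 1
    ext a
    simp
  rwa [e, bot_sup_eq] at h2

end

/-! ### Depth, associated primes and prime avoidance. -/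

section

variable {R : Type*} [CommRing R] [IsLocalRing R]

open IsLocalRing

/-- The depth of `R ⧸ J` is at least `n`. -/
def DepthAtLeast (n : ℕ) (J : Ideal R) : Prop :=
  ∃ l : List R, l.length = n ∧ (∀ a ∈ l, a ∈ maximalIdeal R) ∧ IsRegularSeqMod J l

theorem depthAtLeast_zero (J : Ideal R) : DepthAtLeast 0 J := ⟨[], rfl, by simp, trivial⟩

theorem depthAtLeast_succ {n : ℕ} {J : Ideal R} :
    DepthAtLeast (n + 1) J ↔
      ∃ s ∈ maximalIdeal R, IsRegularMod J s ∧ DepthAtLeast n (J ⊔ Ideal.span {s}) := by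
  constructor
  · rintro ⟨_ | ⟨s, l⟩, h1, h2, h3⟩
    · simp at h1
    · exact ⟨s, h2 s (by simp), h3.1, l, by simpa using h1,
        fun a ha => h2 a (List.mem_cons_of_mem _ ha), h3.2⟩
  · rintro ⟨s, hs, hr, l, h1, h2, h3⟩
    exact ⟨s :: l, by simp [h1], by simpa using ⟨hs, h2⟩, hr, h3⟩

end

section

variable {R : Type*} [CommRing R] [IsNoetherianRing R]

theorem Ideal.finite_associatedPrimes (J : Ideal R) : (Submodule.associatedPrimes J).Finite := by
  classical
  obtain ⟨T, hT⟩ := Submodule.IsLasker.exists_isMinimalPrimaryDecomposition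
    (Submodule.isLasker R R) J
  rw [← hT.image_radical_eq_associated_primes]
  exact T.finite_toSet.image _

theorem Ideal.minimalPrimes_subset_associatedPrimes (J : Ideal R) :
    J.minimalPrimes ⊆ Submodule.associatedPrimes J := by
  obtain ⟨T, hT⟩ := Submodule.IsLasker.exists_isMinimalPrimaryDecomposition
    (Submodule.isLasker R R) J
  rw [← hT.image_radical_eq_associated_primes]
  simpa using Ideal.IsMinimalPrimaryDecomposition.minimalPrimes_subset_image_radical hT

/-- Some primary component of J misses b; its radical is the required prime. -/
theorem Ideal.exists_associatedPrime_colon_le {J : Ideal R} {b : R} (hb : b ∉ J) :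
    ∃ p ∈ Submodule.associatedPrimes J, ∀ s, s * b ∈ J → s ∈ p := by
  obtain ⟨T, hT⟩ := Submodule.IsLasker.exists_isMinimalPrimaryDecomposition
    (Submodule.isLasker R R) J
  have h : ∃ q ∈ T, b ∉ q := by
    by_contra! h
    apply hb
    rw [← hT.inf_eq, Submodule.mem_finsetInf]
    exact h
  obtain ⟨q, hq, hbq⟩ := h
  refine ⟨Ideal.radical q, ?_, fun s hs => ?_⟩
  · simpa using hT.mem_associatedPrimes hq
  · rw [← hT.inf_eq, Submodule.mem_finsetInf] at hs
    have := (Ideal.isPrimary_iff.1 (hT.primary hq)).2 (x := b) (y := s)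
      (by rw [mul_comm]; exact hs q hq)
    exact this.resolve_left hbq

theorem Ideal.exists_mem_iff_of_mem_associatedPrimes {J p : Ideal R}
    (hp : p ∈ Submodule.associatedPrimes J) : p.IsPrime ∧ ∃ b, ∀ s, s ∈ p ↔ s * b ∈ J := by
  obtain ⟨h, b, rfl⟩ := Submodule.isAssociatedPrime_iff.1 hp
  exact ⟨h, b, fun s => by rw [Submodule.mem_colon_singleton, smul_eq_mul]⟩

theorem Ideal.le_of_mem_associatedPrimes {J p : Ideal R}
    (hp : p ∈ Submodule.associatedPrimes J) : J ≤ p := by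
  obtain ⟨-, b, hb⟩ := Ideal.exists_mem_iff_of_mem_associatedPrimes hp
  exact fun s hs => (hb s).2 (Ideal.mul_mem_right _ _ hs)

theorem isRegularMod_iff {J : Ideal R} {s : R} :
    IsRegularMod J s ↔ ∀ p ∈ Submodule.associatedPrimes J, s ∉ p := by
  constructor
  · intro h p hp hs
    obtain ⟨hpp, b, hb⟩ := Ideal.exists_mem_iff_of_mem_associatedPrimes hp
    have := h b ((hb s).1 hs)
    exact hpp.ne_top ((Ideal.eq_top_iff_one p).2 ((hb 1).2 (by simpa using this)))
  · intro h a ha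
    by_contra haJ
    obtain ⟨p, hp, hpa⟩ := Ideal.exists_associatedPrime_colon_le haJ
    exact h p hp (hpa s ha)

/-- Prime avoidance for the associated primes of an ideal. -/
theorem Ideal.exists_mem_forall_associatedPrimes (I J : Ideal R) :
    ∃ z ∈ I, ∀ p ∈ Submodule.associatedPrimes J, z ∈ p → I ≤ p := by
  have hfin : {p ∈ Submodule.associatedPrimes J | ¬ I ≤ p}.Finite :=
    (Ideal.finite_associatedPrimes J).subset fun p hp => hp.1
  have h := (Ideal.subset_union_prime_finite hfin (f := id) (I := I) ⊥ ⊥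
    fun p hp _ _ => (Ideal.exists_mem_iff_of_mem_associatedPrimes hp.1).1).not.2
    (by rintro ⟨p, hp, hI⟩; exact hp.2 hI)
  obtain ⟨z, hz, hz'⟩ := Set.not_subset.1 h
  refine ⟨z, hz, fun p hp hzp => ?_⟩
  by_contra hI
  exact hz' (Set.mem_biUnion (show p ∈ {p ∈ Submodule.associatedPrimes J | ¬ I ≤ p} from
    ⟨hp, hI⟩) hzp)

end

theorem ringKrullDim_quotient_add_one_le_of_lt {R : Type*} [CommRing R] {p q : Ideal R}
    [p.IsPrime] (h : p < q) :
    ringKrullDim (R ⧸ q) + 1 ≤ ringKrullDim (R ⧸ p) := by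
  obtain ⟨r, hrq, hrp⟩ := SetLike.exists_of_lt h
  refine ringKrullDim_succ_le_of_surjective (Ideal.Quotient.factor h.le)
    (Ideal.Quotient.factor_surjective h.le) (r := Ideal.Quotient.mk p r) ?_ ?_
  · refine mem_nonZeroDivisors_of_ne_zero fun h0 => hrp (Ideal.Quotient.eq_zero_iff_mem.1 h0)
  · rw [Ideal.Quotient.factor_mk]
    exact Ideal.Quotient.eq_zero_iff_mem.2 hrq

/-! ### Depth against dimension: systems of parameters are regular. -/

section

variable {R : Type*} [CommRing R] [IsLocalRing R] [IsNoetherianRing R]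

open IsLocalRing

theorem IsRegularMod.maximalIdeal_notMem {J : Ideal R} {s : R} (h : IsRegularMod J s)
    (hs : s ∈ maximalIdeal R) : maximalIdeal R ∉ Submodule.associatedPrimes J :=
  fun hm => isRegularMod_iff.1 h _ hm hs

theorem exists_isRegularMod_of_maximalIdeal_notMem {S : Set (Ideal R)} (hS : S.Finite)
    (h : ∀ J ∈ S, maximalIdeal R ∉ Submodule.associatedPrimes J) :
    ∃ c ∈ maximalIdeal R, ∀ J ∈ S, IsRegularMod J c := by
  have hfin : (⋃ J ∈ S, Submodule.associatedPrimes J).Finite :=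
    hS.biUnion fun J _ => Ideal.finite_associatedPrimes J
  have hp : ∀ p ∈ ⋃ J ∈ S, Submodule.associatedPrimes J, p.IsPrime := by
    intro p hp
    simp only [Set.mem_iUnion] at hp
    obtain ⟨J, -, hp⟩ := hp
    exact (Ideal.exists_mem_iff_of_mem_associatedPrimes hp).1
  have h := (Ideal.subset_union_prime_finite hfin (f := id) (I := maximalIdeal R) ⊥ ⊥
    fun p hp' _ _ => hp p hp').not.2 (by
      rintro ⟨p, hpS, hle⟩
      have : maximalIdeal R = p := (maximalIdeal.isMaximal R).eq_of_le (hp p hpS).ne_top hle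
      simp only [Set.mem_iUnion] at hpS
      obtain ⟨J, hJ, hpJ⟩ := hpS
      exact h J hJ (this ▸ hpJ))
  obtain ⟨c, hc, hc'⟩ := Set.not_subset.1 h
  refine ⟨c, hc, fun J hJ => isRegularMod_iff.2 fun p hpJ hcp => hc' ?_⟩
  exact Set.mem_biUnion (Set.mem_biUnion hJ hpJ) hcp

/-- Depth two at J leaves depth one after dividing by any regular z. If e were a socle element
modulo J + (z), then s e ≡ z e' and s' e ≡ z f modulo J; cancelling z gives s' e' ≡ s f, so s
divides e' modulo J, and cancelling s puts e in J + (z). -/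
theorem maximalIdeal_notMem_associatedPrimes_sup {J : Ideal R} {s s' z : R}
    (hs : IsRegularMod J s) (hs' : IsRegularMod (J ⊔ Ideal.span {s}) s')
    (hsm : s ∈ maximalIdeal R) (hsm' : s' ∈ maximalIdeal R) (hz : IsRegularMod J z) :
    maximalIdeal R ∉ Submodule.associatedPrimes (J ⊔ Ideal.span {z}) := by
  intro hm
  obtain ⟨hpr, e, he⟩ := Ideal.exists_mem_iff_of_mem_associatedPrimes hm
  obtain ⟨e', he'⟩ := Ideal.mem_sup_span_singleton_iff.1 ((he s).1 hsm)
  obtain ⟨f, hf⟩ := Ideal.mem_sup_span_singleton_iff.1 ((he s').1 hsm')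
  have h1 : s' * e' - s * f ∈ J := by
    refine hz _ ?_
    convert sub_mem (Ideal.mul_mem_left _ s hf) (Ideal.mul_mem_left _ s' he') using 1
    ring
  obtain ⟨h, hh⟩ := Ideal.mem_sup_span_singleton_iff.1
    (hs' e' (Ideal.mem_sup_span_singleton_iff.2 ⟨f, h1⟩))
  have h2 : e - z * h ∈ J := by
    refine hs _ ?_
    convert add_mem he' (Ideal.mul_mem_left _ z hh) using 1
    ring
  refine hpr.ne_top ((Ideal.eq_top_iff_one _).2 ((he 1).2 ?_))
  rw [one_mul]
  exact Ideal.mem_sup_span_singleton_iff.2 ⟨h, h2⟩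

theorem DepthAtLeast.sup_span {n : ℕ} {J : Ideal R} {z : R} (h : DepthAtLeast (n + 1) J)
    (hzm : z ∈ maximalIdeal R) (hz : IsRegularMod J z) :
    DepthAtLeast n (J ⊔ Ideal.span {z}) := by
  induction n generalizing J z with
  | zero => exact depthAtLeast_zero _
  | succ n ih =>
    obtain ⟨s, hsm, hs, h'⟩ := depthAtLeast_succ.1 h
    obtain ⟨s', hsm', hs', -⟩ := depthAtLeast_succ.1 h'
    -- The element c, regular after both s and z, is a bridge: the induction hypothesis first
    -- exchanges s for c, then applies to z modulo J + (c).
    obtain ⟨c, hcm, hc⟩ := exists_isRegularMod_of_maximalIdeal_notMem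
      (S := {J ⊔ Ideal.span {s}, J ⊔ Ideal.span {z}}) (by simp) (by
        rintro _ (rfl | rfl)
        · exact hs'.maximalIdeal_notMem hsm'
        · exact maximalIdeal_notMem_associatedPrimes_sup hs hs' hsm hsm' hz)
    have hc1 := hc (J ⊔ Ideal.span {s}) (by simp)
    have hc2 := hc (J ⊔ Ideal.span {z}) (by simp)
    have hcJ : IsRegularMod J c := hs.of_sup_span hsm hc1
    have h1 : DepthAtLeast (n + 1) (J ⊔ Ideal.span {c}) := by
      refine depthAtLeast_succ.2 ⟨s, hsm, hs.sup_span_swap hc1, ?_⟩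
      rw [sup_right_comm]
      exact ih h' hcm hc1
    refine depthAtLeast_succ.2 ⟨c, hcm, hc2, ?_⟩
    rw [sup_right_comm]
    exact ih h1 hzm (hz.sup_span_swap hc2)

theorem DepthAtLeast.sup_ofList {n : ℕ} {l : List R} {J : Ideal R}
    (h : DepthAtLeast (n + l.length) J) (hlm : ∀ a ∈ l, a ∈ maximalIdeal R)
    (hl : IsRegularSeqMod J l) : DepthAtLeast n (J ⊔ Ideal.ofList l) := by
  induction l generalizing J with
  | nil => simpa using h
  | cons s l ih =>
    rw [List.length_cons, ← add_assoc] at h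
    have := ih (h.sup_span (hlm s (by simp)) hl.1) (fun a ha => hlm a (List.mem_cons_of_mem _ ha))
      hl.2
    rwa [Ideal.ofList_cons, ← sup_assoc]

/-- Let N = (J : p). If N were inside J + (s), cancelling s and applying Nakayama would give N ⊆ J,
although N contains the element b with p = (J : b). So some c in N is nonzero modulo J + (s), and an
associated prime containing its annihilator contains p. -/
theorem exists_associatedPrime_sup_span_ge {J p : Ideal R} {s : R} (hs : IsRegularMod J s)
    (hsm : s ∈ maximalIdeal R) (hp : p ∈ Submodule.associatedPrimes J) :
    ∃ q ∈ Submodule.associatedPrimes (J ⊔ Ideal.span {s}), p ≤ q := by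
  obtain ⟨hpr, b, hb⟩ := Ideal.exists_mem_iff_of_mem_associatedPrimes hp
  -- the elements killed by `p`
  let N : Ideal R := ⨅ r : p, J.colon {(r : R)}
  have hN : ∀ c, c ∈ N ↔ ∀ r ∈ p, r * c ∈ J := fun c => by
    simp [N, Submodule.mem_iInf, Submodule.mem_colon_singleton, mul_comm]
  have hNs : ∃ c ∈ N, c ∉ J ⊔ Ideal.span {s} := by
    by_contra! hle
    have hle' : N ≤ J ⊔ maximalIdeal R • N := by
      intro c hc
      obtain ⟨d, hd⟩ := Ideal.mem_sup_span_singleton_iff.1 (hle c hc)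
      have hdN : d ∈ N := by
        rw [hN] at hc ⊢
        intro r hr
        refine hs _ ?_
        convert sub_mem (hc r hr) (Ideal.mul_mem_left _ r hd) using 1
        ring
      have : c = (c - s * d) + s * d := by ring
      rw [this]
      exact add_mem (Ideal.mem_sup_left hd) (Ideal.mem_sup_right (Submodule.smul_mem_smul hsm hdN))
    have hNJ := Submodule.le_of_le_smul_of_le_jacobson_bot (IsNoetherian.noetherian N)
      (maximalIdeal_le_jacobson ⊥) hle'
    have hbJ : b ∈ J := hNJ ((hN b).2 fun r hr => (hb r).1 hr)
    exact hpr.ne_top ((Ideal.eq_top_iff_one p).2 ((hb 1).2 (by simpa using hbJ)))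
  obtain ⟨c, hc, hcs⟩ := hNs
  obtain ⟨q, hq, hqc⟩ := Ideal.exists_associatedPrime_colon_le hcs
  exact ⟨q, hq, fun r hr => hqc r (Ideal.mem_sup_left ((hN c).1 hc r hr))⟩

/-- Depth bounds the dimension at every associated prime, so a Cohen–Macaulay ring is unmixed: each
regular element gives a strictly larger prime. -/
theorem DepthAtLeast.le_ringKrullDim_quotient {n : ℕ} {J p : Ideal R} (h : DepthAtLeast n J)
    (hp : p ∈ Submodule.associatedPrimes J) : (n : WithBot ℕ∞) ≤ ringKrullDim (R ⧸ p) := by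
  induction n generalizing J p with
  | zero =>
    have := (Ideal.exists_mem_iff_of_mem_associatedPrimes hp).1
    simpa using ringKrullDim_nonneg_of_nontrivial (R := R ⧸ p)
  | succ n ih =>
    obtain ⟨s, hsm, hs, h'⟩ := depthAtLeast_succ.1 h
    obtain ⟨q, hq, hpq⟩ := exists_associatedPrime_sup_span_ge hs hsm hp
    have := (Ideal.exists_mem_iff_of_mem_associatedPrimes hp).1
    have hsq : s ∈ q :=
      Ideal.le_of_mem_associatedPrimes hq (Ideal.mem_sup_right (Ideal.mem_span_singleton_self s))
    have hlt : p < q := lt_of_le_of_ne hpq fun e => isRegularMod_iff.1 hs p hp (e ▸ hsq)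
    refine le_trans ?_ (ringKrullDim_quotient_add_one_le_of_lt hlt)
    push_cast
    gcongr
    exact ih h' hq

/-- Krull's height theorem in R/p, whose maximal ideal is minimal over the image of the list. -/
theorem ringKrullDim_quotient_le_length {p : Ideal R} [p.IsPrime] {l : List R}
    (h : maximalIdeal R ≤ (p ⊔ Ideal.ofList l).radical) (hl : ∀ a ∈ l, a ∈ maximalIdeal R) :
    ringKrullDim (R ⧸ p) ≤ l.length := by
  have hloc : IsLocalRing (R ⧸ p) :=
    IsLocalRing.of_surjective' (Ideal.Quotient.mk p) Ideal.Quotient.mk_surjective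
  have hmap : maximalIdeal (R ⧸ p) = (maximalIdeal R).map (Ideal.Quotient.mk p) :=
    (map_maximalIdeal_of_surjective _ Ideal.Quotient.mk_surjective).symm
  have hmin : maximalIdeal (R ⧸ p) ∈
      (Ideal.span (Ideal.Quotient.mk p '' {a | a ∈ l})).minimalPrimes := by
    refine ⟨⟨inferInstance, ?_⟩, ?_⟩
    · rw [Ideal.span_le]
      rintro _ ⟨a, ha, rfl⟩
      rw [hmap]
      exact Ideal.mem_map_of_mem _ (hl a ha)
    · rintro q ⟨hq, hle⟩ -
      rw [hmap, Ideal.map_le_iff_le_comap]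
      refine h.trans ?_
      rw [Ideal.IsPrime.radical_le_iff (Ideal.IsPrime.comap _)]
      refine sup_le ?_ ?_
      · intro a ha
        rw [Ideal.mem_comap, Ideal.Quotient.eq_zero_iff_mem.2 ha]
        exact zero_mem q
      · rw [Ideal.ofList, Ideal.span_le]
        intro a ha
        exact hle (Ideal.subset_span ⟨a, ha, rfl⟩)
  rw [← maximalIdeal_height_eq_ringKrullDim]
  have h1 := Ideal.height_le_card_of_mem_minimalPrimes_span ((List.finite_toSet l).image _) hmin
  have h2 : (Ideal.Quotient.mk p '' {a | a ∈ l}).ncard ≤ l.length := by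
    classical
    refine (Set.ncard_image_le (List.finite_toSet l)).trans ?_
    have : {a | a ∈ l} = (l.toFinset : Set R) := by ext; simp
    rw [this, Set.ncard_coe_finset]
    exact List.toFinset_card_le l
  have h3 : ((Ideal.Quotient.mk p '' {a | a ∈ l}).ncard : ℕ∞) ≤ l.length := by exact_mod_cast h2
  exact_mod_cast h1.trans h3

/-- In a Cohen–Macaulay ring every system of parameters is a regular sequence. -/
theorem DepthAtLeast.isRegularSeqMod {l : List R} {J : Ideal R}
    (h : DepthAtLeast l.length J) (hl : ∀ a ∈ l, a ∈ maximalIdeal R)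
    (hrad : maximalIdeal R ≤ (J ⊔ Ideal.ofList l).radical) : IsRegularSeqMod J l := by
  induction l generalizing J with
  | nil => trivial
  | cons s l ih =>
    have hl' : ∀ a ∈ l, a ∈ maximalIdeal R := fun a ha => hl a (List.mem_cons_of_mem _ ha)
    -- If s lay in an associated prime p, the remaining elements alone would bound dim R/p by one
    -- less than the depth.
    have hs : IsRegularMod J s := by
      refine isRegularMod_iff.2 fun p hp hsp => ?_
      have hpr := (Ideal.exists_mem_iff_of_mem_associatedPrimes hp).1
      have h1 := h.le_ringKrullDim_quotient hp
      have h2 := ringKrullDim_quotient_le_length (p := p) (l := l) (hrad.trans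
        (Ideal.radical_mono (by
          rw [Ideal.ofList_cons, ← sup_assoc]
          refine sup_le_sup_right (sup_le (Ideal.le_of_mem_associatedPrimes hp) ?_) _
          rwa [Ideal.span_singleton_le_iff_mem]))) hl'
      have h3 := h1.trans h2
      rw [List.length_cons] at h3
      have : l.length + 1 ≤ l.length := by exact_mod_cast h3
      omega
    refine ⟨hs, ih ?_ hl' ?_⟩
    · rw [List.length_cons] at h
      exact h.sup_span (hl s (by simp)) hs
    · rwa [Ideal.ofList_cons, ← sup_assoc] at hrad

end

/-! ### Determinants and limit closures. -/

section

variable {R : Type*} [CommRing R]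

theorem exists_pow_succ_mem {r : ℕ} {x : Fin r → R} {I : Ideal R} (h : ∀ i, x i ∈ I.radical) :
    ∃ n : ℕ, ∀ i, x i ^ (n + 1) ∈ I := by
  choose N hN using h
  refine ⟨∑ i, N i, fun i => Ideal.mem_of_dvd _ (pow_dvd_pow _ ?_) (hN i)⟩
  exact (Finset.single_le_sum (f := N) (fun _ _ => Nat.zero_le _) (Finset.mem_univ i)).trans
    (Nat.le_succ _)

theorem span_le_limitClosure {r : ℕ} (x : Fin r → R) :
    Ideal.span (Set.range x) ≤ limitClosure x := by
  intro a ha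
  refine mem_limitClosure.2 ⟨1, one_pos, ?_⟩
  have := mul_prod_pow_mem x 1 1 (a := a) (by simpa using ha)
  exact this

theorem det_mul_mem_limitClosure {r : ℕ} {x y : Fin r → R} {A : Matrix (Fin r) (Fin r) R}
    (h : y = A *ᵥ x) {a : R} (ha : a ∈ limitClosure x) : A.det * a ∈ limitClosure y :=
  limitClosure_le_comap x y A h ha

theorem det_sub_det_mem_limitClosure {r : ℕ} {x z : Fin r → R} {C D : Matrix (Fin r) (Fin r) R}
    (hC : z = C *ᵥ x) (hD : z = D *ᵥ x) : C.det - D.det ∈ limitClosure z :=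
  mem_limitClosure.2 ⟨1, one_pos, by simpa using det_sub_det_mul_prod_mem x z C D hC hD⟩

theorem pow_succ_eq_diagonal_mulVec {r : ℕ} (x : Fin r → R) (n : ℕ) :
    (fun i => x i ^ (n + 1)) = Matrix.diagonal (fun i => x i ^ n) *ᵥ x := by
  ext i
  rw [Matrix.mulVec_diagonal, pow_succ]

theorem prod_pow_mul_mem_limitClosure_pow {r : ℕ} {x : Fin r → R} (n : ℕ) {a : R}
    (ha : a ∈ limitClosure x) :
    (∏ i, x i) ^ n * a ∈ limitClosure fun i => x i ^ (n + 1) := by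
  have := det_mul_mem_limitClosure (pow_succ_eq_diagonal_mulVec x n) ha
  rwa [Matrix.det_diagonal, Finset.prod_pow] at this

theorem mem_limitClosure_of_prod_pow_mul_mem {r : ℕ} {x : Fin r → R} {n : ℕ} {a : R}
    (ha : (∏ i, x i) ^ n * a ∈ limitClosure fun i => x i ^ (n + 1)) : a ∈ limitClosure x := by
  obtain ⟨m, hm, ha⟩ := mem_limitClosure.1 ha
  -- The generators (x_i^(n+1))^(m+1) have exponent (n+1)(m+1), and the multipliers combine to n +
  -- (n+1)m, exactly one less.
  refine mem_limitClosure.2 ⟨(n + 1) * (m + 1) - 1, ?_, ?_⟩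
  · have : (n + 1) * (m + 1) ≥ 1 * 2 := Nat.mul_le_mul (by omega) (by omega)
    omega
  · have e : (n + 1) * (m + 1) - 1 + 1 = (n + 1) * (m + 1) := by
      have : (n + 1) * (m + 1) ≥ 1 * 1 := Nat.mul_le_mul (by omega) (by omega)
      omega
    have e' : (n + 1) * (m + 1) - 1 = n + (n + 1) * m := by
      have : (n + 1) * (m + 1) = n + (n + 1) * m + 1 := by ring
      omega
    rw [e, e', pow_add]
    simp only [Finset.prod_pow, ← pow_mul] at ha
    convert ha using 1
    ring

/-- If `y = A x` and `(x)` lies in the radical of `(y)`, then the determinantal map is injective. -/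
theorem mem_limitClosure_of_det_mul_mem {r : ℕ} {x y : Fin r → R} {A : Matrix (Fin r) (Fin r) R}
    (h : y = A *ᵥ x) (hxy : ∀ i, x i ∈ (Ideal.span (Set.range y)).radical) {a : R}
    (ha : A.det * a ∈ limitClosure y) : a ∈ limitClosure x := by
  obtain ⟨n, hn⟩ := exists_pow_succ_mem hxy
  obtain ⟨B, hB⟩ := exists_mulVec_of_mem_span y _ hn
  have h1 := det_mul_mem_limitClosure hB ha
  have h2 : (fun i => x i ^ (n + 1)) = (B * A) *ᵥ x := by
    rw [← Matrix.mulVec_mulVec, ← h]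
    exact hB
  -- Both B A and the diagonal matrix send x to its powers, so det B · det A may be replaced by the
  -- n-th power of ∏ x_i.
  have h3 := det_sub_det_mem_limitClosure h2 (pow_succ_eq_diagonal_mulVec x n)
  rw [Matrix.det_mul, Matrix.det_diagonal, Finset.prod_pow] at h3
  refine mem_limitClosure_of_prod_pow_mul_mem (n := n) ?_
  convert sub_mem h1 (Ideal.mul_mem_left _ a h3) using 1
  ring

theorem mk_mem_limitClosure_iff {r : ℕ} {x : Fin r → R} {J : Ideal R} {a : R} :
    Ideal.Quotient.mk J a ∈ limitClosure (fun i => Ideal.Quotient.mk J (x i)) ↔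
      ∃ n > 0, a * (∏ i, x i) ^ n ∈ Ideal.span (Set.range fun i => x i ^ (n + 1)) ⊔ J := by
  rw [mem_limitClosure]
  refine exists_congr fun n => and_congr_right fun _ => ?_
  have e : Ideal.span (Set.range fun i => Ideal.Quotient.mk J (x i) ^ (n + 1)) =
      (Ideal.span (Set.range fun i => x i ^ (n + 1))).map (Ideal.Quotient.mk J) := by
    rw [Ideal.map_span, ← Set.range_comp]
    congr 2
  rw [e, ← map_prod, ← map_pow, ← map_mul, ← Ideal.mem_comap,
    Ideal.comap_map_of_surjective _ Ideal.Quotient.mk_surjective, ← RingHom.ker_eq_comap_bot,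
    Ideal.mk_ker]

/-! ### Generic sequences in an ideal. -/

theorem span_image_Iio_succ (z : ℕ → R) (n : ℕ) :
    Ideal.span (z '' Set.Iio (n + 1)) = Ideal.span (z '' Set.Iio n) ⊔ Ideal.span {z n} := by
  have : Set.Iio (n + 1) = insert n (Set.Iio n) := by
    ext; simp only [Set.mem_Iio, Set.mem_insert_iff]; omega
  rw [this, Set.image_insert_eq, Ideal.span_insert, sup_comm]

theorem image_Iio_eq_range {α : Type*} (z : ℕ → α) (n : ℕ) :
    z '' Set.Iio n = Set.range fun i : Fin n => z i := by
  ext a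
  constructor
  · rintro ⟨i, hi, rfl⟩
    exact ⟨⟨i, hi⟩, rfl⟩
  · rintro ⟨i, rfl⟩
    exact ⟨i, i.2, rfl⟩

theorem ofList_ofFn {r : ℕ} (v : Fin r → R) :
    Ideal.ofList (List.ofFn v) = Ideal.span (Set.range v) := by
  rw [Ideal.ofList]
  congr 1
  ext a
  simp [List.mem_ofFn']

theorem isRegularSeqMod_ofFn {z : ℕ → R} {n : ℕ}
    (h : ∀ i < n, IsRegularMod (Ideal.span (z '' Set.Iio i)) (z i)) :
    IsRegularSeqMod ⊥ (List.ofFn fun i : Fin n => z i) := by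
  induction n with
  | zero => simp [IsRegularSeqMod]
  | succ n ih =>
    rw [List.ofFn_succ_last, IsRegularSeqMod.append]
    refine ⟨ih fun i hi => h i (by omega), ?_⟩
    have := h n (by omega)
    rw [image_Iio_eq_range] at this
    simpa [IsRegularSeqMod, ofList_ofFn] using this

/-- A prime q not containing I sits over a minimal prime p of the first n elements; p does not
contain I either, so it misses the next element and p < q. Each element thus raises the height. -/
theorem le_height_of_span_image_Iio_le {z : ℕ → R} {I : Ideal R} {n : ℕ}
    (h : ∀ i < n, ∀ p ∈ (Ideal.span (z '' Set.Iio i)).minimalPrimes, z i ∈ p → I ≤ p)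
    {q : Ideal R} [q.IsPrime] (hq : Ideal.span (z '' Set.Iio n) ≤ q) (hI : ¬ I ≤ q) :
    (n : ℕ∞) ≤ q.height := by
  induction n generalizing q with
  | zero => simp
  | succ n ih =>
    rw [span_image_Iio_succ] at hq
    obtain ⟨p, hp, hpq⟩ := Ideal.exists_minimalPrimes_le (le_sup_left.trans hq)
    have hpr : p.IsPrime := hp.1.1
    have hIp : ¬ I ≤ p := fun h' => hI (h'.trans hpq)
    have h1 := ih (fun i hi => h i (by omega)) hp.1.2 hIp
    have hzq : z n ∈ q := hq (Ideal.mem_sup_right (Ideal.mem_span_singleton_self _))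
    have hlt : p < q := lt_of_le_of_ne hpq fun e => hIp (h n (by omega) p hp (e ▸ hzq))
    refine le_trans ?_ (Ideal.height_add_one_le_of_lt_of_isPrime hlt)
    push_cast
    gcongr

end

section

variable {R : Type*} [CommRing R] [IsNoetherianRing R]

theorem exists_generic_sequence (I : Ideal R) :
    ∃ z : ℕ → R, (∀ i, z i ∈ I) ∧
      ∀ i, ∀ p ∈ Submodule.associatedPrimes (Ideal.span (z '' Set.Iio i)), z i ∈ p → I ≤ p := by
  choose f hf hf' using Ideal.exists_mem_forall_associatedPrimes I
  let J : ℕ → Ideal R := fun n => Nat.rec ⊥ (fun _ K => K ⊔ Ideal.span {f K}) n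
  have hJ : ∀ n, Ideal.span ((fun i => f (J i)) '' Set.Iio n) = J n := by
    intro n
    induction n with
    | zero => simp [J]
    | succ n ih => rw [span_image_Iio_succ, ih]
  refine ⟨fun i => f (J i), fun i => hf _, fun i p hp => ?_⟩
  rw [hJ] at hp
  exact hf' _ p hp

end

section

variable {R : Type*} [CommRing R] [IsLocalRing R] [IsNoetherianRing R]

open IsLocalRing

theorem eq_maximalIdeal_of_ringKrullDim_le_height {n : ℕ} (hn : ringKrullDim R ≤ n) {q : Ideal R}
    [q.IsPrime] (h : (n : ℕ∞) ≤ q.height) : q = maximalIdeal R := by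
  refine Ideal.height_eq_ringKrullDim_iff.1 (le_antisymm Ideal.height_le_ringKrullDim_of_isPrime ?_)
  exact hn.trans (by exact_mod_cast h)

/-- A prime containing the n elements but not I would have height at least dim R, hence be the
maximal ideal, which contains I. -/
theorem le_radical_span_image_Iio {z : ℕ → R} {I : Ideal R} (hI : I ≤ maximalIdeal R) {n : ℕ}
    (hn : ringKrullDim R ≤ n)
    (h : ∀ i < n, ∀ p ∈ (Ideal.span (z '' Set.Iio i)).minimalPrimes, z i ∈ p → I ≤ p) :
    I ≤ (Ideal.span (z '' Set.Iio n)).radical := by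
  rw [Ideal.radical_eq_sInf]
  refine le_sInf ?_
  rintro q ⟨hq, hqp⟩
  by_contra hIq
  have := eq_maximalIdeal_of_ringKrullDim_le_height hn (le_height_of_span_image_Iio_le h hq hIq)
  exact hIq (this ▸ hI)

/-- A regular sequence of length `dim R` generates an ideal that is primary to the maximal ideal. -/
theorem maximalIdeal_le_radical_span_of_isRegularMod {z : ℕ → R} {n : ℕ}
    (hn : ringKrullDim R ≤ n)
    (h : ∀ i < n, IsRegularMod (Ideal.span (z '' Set.Iio i)) (z i)) :
    maximalIdeal R ≤ (Ideal.span (z '' Set.Iio n)).radical :=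
  le_radical_span_image_Iio le_rfl hn fun i hi p hp hz =>
    absurd hz (isRegularMod_iff.1 (h i hi) p (Ideal.minimalPrimes_subset_associatedPrimes _ hp))

/-! ### Limit closures modulo elements with large annihilator. -/

/-- Fewer than t generic elements already generate (y) up to radical. Padding them with a zero makes
the product vanish, so their limit closure is everything, and injectivity of the determinantal map
pulls 1 back to y. -/
theorem limitClosure_eq_top_of_ringKrullDim_lt {t : ℕ} (ht : ringKrullDim R < t) {y : Fin t → R}
    (hy : ∀ i, y i ∈ maximalIdeal R) : limitClosure y = ⊤ := by
  obtain _ | t := t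
  · have := ringKrullDim_nonneg_of_nontrivial (R := R)
    exact absurd ht (not_lt.2 (by simpa using this))
  have ht' : ringKrullDim R ≤ t := by
    rw [← maximalIdeal_height_eq_ringKrullDim] at ht ⊢
    have : (maximalIdeal R).height < ((t + 1 : ℕ) : ℕ∞) := by exact_mod_cast ht
    push_cast at this
    exact_mod_cast ENat.lt_natCast_add_one_iff.1 this
  set I := Ideal.span (Set.range y) with hI
  have hIm : I ≤ maximalIdeal R := by
    rw [hI, Ideal.span_le]
    rintro _ ⟨i, rfl⟩
    exact hy i
  obtain ⟨z, hzI, hz⟩ := exists_generic_sequence I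
  have hrad := le_radical_span_image_Iio hIm ht' fun i _ p hp hzp =>
    hz i p (Ideal.minimalPrimes_subset_associatedPrimes _ hp) hzp
  let w : Fin (t + 1) → R := Fin.snoc (fun i : Fin t => z i) 0
  have hw : ∀ i, w i ∈ I := by
    intro i
    refine Fin.lastCases ?_ (fun j => ?_) i
    · simp [w]
    · simpa [w] using hzI j
  obtain ⟨C, hC⟩ := exists_mulVec_of_mem_span y w hw
  have hle : Ideal.span (z '' Set.Iio t) ≤ Ideal.span (Set.range w) := by
    rw [image_Iio_eq_range]
    refine Ideal.span_mono ?_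
    rintro _ ⟨i, rfl⟩
    exact ⟨i.castSucc, by simp [w]⟩
  have hw0 : limitClosure w = ⊤ := by
    rw [Ideal.eq_top_iff_one, mem_limitClosure]
    refine ⟨1, one_pos, ?_⟩
    have : ∏ i, w i = 0 := Finset.prod_eq_zero (Finset.mem_univ (Fin.last t)) (by simp [w])
    simp [this]
  rw [Ideal.eq_top_iff_one]
  refine mem_limitClosure_of_det_mul_mem hC (fun i => ?_) (by rw [hw0]; trivial)
  exact Ideal.radical_mono hle (hrad (Ideal.subset_span ⟨i, rfl⟩))

theorem mem_limitClosure_of_ringKrullDim_lt {t : ℕ} {u : R}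
    (hu : ringKrullDim (R ⧸ (⊥ : Ideal R).colon {u}) < t) {y : Fin t → R}
    (hy : ∀ i, y i ∈ maximalIdeal R) : u ∈ limitClosure y := by
  set J : Ideal R := (⊥ : Ideal R).colon {u} with hJ
  have hJu : ∀ s, s ∈ J ↔ s * u = 0 := fun s => by
    rw [hJ, Submodule.mem_colon_singleton, smul_eq_mul, Submodule.mem_bot]
  by_cases hJtop : J = ⊤
  · have : (1 : R) ∈ J := hJtop ▸ trivial
    rw [hJu, one_mul] at this
    rw [this]
    exact zero_mem _
  have : Nontrivial (R ⧸ J) := Ideal.Quotient.nontrivial_iff.2 hJtop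
  have hloc : IsLocalRing (R ⧸ J) :=
    IsLocalRing.of_surjective' (Ideal.Quotient.mk J) Ideal.Quotient.mk_surjective
  have h := limitClosure_eq_top_of_ringKrullDim_lt hu
    (y := fun i => Ideal.Quotient.mk J (y i)) (fun i => by
      rw [← map_maximalIdeal_of_surjective _ (Ideal.Quotient.mk_surjective (I := J))]
      exact Ideal.mem_map_of_mem _ (hy i))
  -- Membership of 1 modulo ann(u), multiplied by u, becomes membership of u in R.
  have h1 : Ideal.Quotient.mk J 1 ∈ limitClosure fun i => Ideal.Quotient.mk J (y i) := by
    rw [h]; trivial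
  obtain ⟨n, hn, h1⟩ := mk_mem_limitClosure_iff.1 h1
  rw [one_mul] at h1
  obtain ⟨a, ha, b, hb, hab⟩ := Submodule.mem_sup.1 h1
  refine mem_limitClosure.2 ⟨n, hn, ?_⟩
  rw [← hab, mul_add, mul_comm u b, (hJu b).1 hb, add_zero]
  exact Ideal.mul_mem_left _ _ ha

/-- If every element of `J` is killed by an ideal of dimension smaller than `t`, then limit closures
of sequences of length `t` can be computed modulo `J`. -/
theorem mk_mem_limitClosure_iff_mem {t : ℕ} {J : Ideal R}
    (hJ : ∀ u ∈ J, ringKrullDim (R ⧸ (⊥ : Ideal R).colon {u}) < t) {x : Fin t → R}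
    (hx : ∀ i, x i ∈ maximalIdeal R) {a : R} :
    Ideal.Quotient.mk J a ∈ limitClosure (fun i => Ideal.Quotient.mk J (x i)) ↔
      a ∈ limitClosure x := by
  rw [mk_mem_limitClosure_iff]
  constructor
  · rintro ⟨n, -, h⟩
    refine mem_limitClosure_of_prod_pow_mul_mem (n := n) ?_
    rw [mul_comm]
    have hle : J ≤ limitClosure fun i => x i ^ (n + 1) := fun u hu =>
      mem_limitClosure_of_ringKrullDim_lt (hJ u hu) fun i =>
      Ideal.pow_mem_of_mem _ (hx i) _ n.succ_pos
    exact sup_le (span_le_limitClosure _) hle h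
  · intro h
    obtain ⟨n, hn, h⟩ := mem_limitClosure.1 h
    exact ⟨n, hn, Ideal.mem_sup_left h⟩

end

/-! ### The converse in a Cohen–Macaulay ring. -/

section

variable {R : Type*} [CommRing R]

theorem mem_limitClosure_append {g d : ℕ} {z : Fin g → R} {w : Fin d → R} {b : R} (j : Fin d)
    (hb : b * w j ∈ Ideal.span (Set.range z)) : b ∈ limitClosure (Fin.append z w) := by
  obtain ⟨c, hc⟩ := Finset.dvd_prod_of_mem w (Finset.mem_univ j)
  refine mem_limitClosure.2 ⟨1, one_pos, ?_⟩
  have h1 := mul_prod_pow_mem z 1 1 (a := b * w j * c) (by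
    simpa using Ideal.mul_mem_right c _ hb)
  have hle : Ideal.span (Set.range fun i => z i ^ (1 + 1)) ≤
      Ideal.span (Set.range fun i => Fin.append z w i ^ (1 + 1)) := by
    refine Ideal.span_mono ?_
    rintro _ ⟨i, rfl⟩
    exact ⟨Fin.castAdd d i, by simp⟩
  convert hle h1 using 1
  rw [Fin.prod_univ_add]
  simp only [Fin.append_left, Fin.append_right, hc]
  ring

end

section

variable {R : Type*} [CommRing R] [IsLocalRing R] [IsNoetherianRing R]

open IsLocalRing

theorem exists_notMem_sup_maximalIdeal_pow {J : Ideal R} {b : R} (hb : b ∉ J) :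
    ∃ k : ℕ, b ∉ J ⊔ maximalIdeal R ^ k := by
  by_contra! h
  apply hb
  rw [← Ideal.Quotient.eq_zero_iff_mem]
  have h0 := Ideal.iInf_pow_smul_eq_bot_of_isLocalRing (M := R ⧸ J) (maximalIdeal R)
    (Ideal.IsPrime.ne_top inferInstance)
  rw [← Submodule.mem_bot R, ← h0, Submodule.mem_iInf]
  intro k
  obtain ⟨j, hj, c, hc, rfl⟩ := Submodule.mem_sup.1 (h k)
  rw [map_add, Ideal.Quotient.eq_zero_iff_mem.2 hj, zero_add]
  have : Ideal.Quotient.mk J c = c • (1 : R ⧸ J) := by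
    rw [Algebra.smul_def, mul_one]; rfl
  rw [this]
  exact Submodule.smul_mem_smul hc trivial

/-- An ideal properly containing `Q`, with `𝔪` in the radical of `Q`, has a socle element
modulo `Q`. -/
theorem exists_socle_element {Q K : Ideal R} (hQ : maximalIdeal R ≤ Q.radical) (hK : ¬ K ≤ Q) :
    ∃ a ∈ K, a ∉ Q ∧ ∀ r ∈ maximalIdeal R, r * a ∈ Q := by
  classical
  obtain ⟨n, hn⟩ := Ideal.exists_pow_le_of_le_radical_of_fg hQ (IsNoetherian.noetherian _)
  -- Take the least such n; an element of 𝔪^(n-1) K outside Q is the socle element.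
  have hex : ∃ n, maximalIdeal R ^ n * K ≤ Q := ⟨n, Ideal.mul_le_left.trans hn⟩
  have hspec := Nat.find_spec hex
  obtain h0 | ⟨m, hm⟩ : Nat.find hex = 0 ∨ ∃ m, Nat.find hex = m + 1 := by
    cases h : Nat.find hex <;> simp
  · rw [h0, pow_zero, one_mul] at hspec
    exact absurd hspec hK
  · have hlt := Nat.find_min hex (show m < Nat.find hex by omega)
    obtain ⟨a, ha, haQ⟩ := Set.not_subset.1 hlt
    refine ⟨a, Ideal.mul_le_right ha, haQ, fun r hr => hspec ?_⟩
    rw [hm, pow_succ', mul_assoc]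
    exact Ideal.mul_mem_mul hr ha

theorem IsPermutableRegular.maximalIdeal_le_radical {t : ℕ} {v : Fin t → R}
    (hv : IsPermutableRegular v) (ht : ringKrullDim R ≤ t) :
    maximalIdeal R ≤ (Ideal.span (Set.range v)).radical := by
  let z : ℕ → R := fun i => if h : i < t then v ⟨i, h⟩ else 0
  have hz : ∀ i ≤ t, z '' Set.Iio i = v '' ((Finset.univ.filter fun j : Fin t => j.1 < i) :
      Finset (Fin t)) := by
    intro i hi
    ext a
    constructor
    · rintro ⟨j, hj, rfl⟩
      have hj : j < i := hj
      exact ⟨⟨j, by omega⟩, by simpa using hj, by simp [z, show j < t by omega]⟩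
    · rintro ⟨j, hj, rfl⟩
      exact ⟨j, by simpa using hj, by simp [z]⟩
  have h := maximalIdeal_le_radical_span_of_isRegularMod (z := z) ht (fun i hi => by
    rw [hz i hi.le]
    have e : z i = v ⟨i, hi⟩ := by simp [z, hi]
    rw [e]
    exact hv _ _ (by simp))
  rw [hz t le_rfl] at h
  refine h.trans (Ideal.radical_mono (Ideal.span_mono ?_))
  rintro _ ⟨j, -, rfl⟩
  exact ⟨j, rfl⟩

/-- Injectivity of a determinantal map to `z` from one regular system of parameters `x` implies
injectivity from any other. -/
theorem IsPermutableRegular.mem_span_of_det_mul_mem {t : ℕ} {x v z : Fin t → R}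
    {E G : Matrix (Fin t) (Fin t) R} (hE : z = E *ᵥ x) (hG : z = G *ᵥ v)
    (hv : IsPermutableRegular v) (hx : IsPermutableRegular x)
    (hxm : ∀ i, x i ∈ maximalIdeal R) (hvm : ∀ i, v i ∈ maximalIdeal R)
    (hxrad : maximalIdeal R ≤ (Ideal.span (Set.range x)).radical)
    (hvrad : maximalIdeal R ≤ (Ideal.span (Set.range v)).radical)
    (H : ∀ a, E.det * a ∈ limitClosure z → a ∈ Ideal.span (Set.range x))
    {b : R} (hb : G.det * b ∈ limitClosure z) : b ∈ Ideal.span (Set.range v) := by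
  obtain ⟨n, hn⟩ := exists_pow_succ_mem fun i => hvrad (hxm i)
  set X : Fin t → R := fun i => x i ^ (n + 1) with hX
  obtain ⟨B, hB⟩ := exists_mulVec_of_mem_span v X hn
  have hXrad : maximalIdeal R ≤ (Ideal.span (Set.range X)).radical := by
    refine hxrad.trans ?_
    rw [Ideal.radical_le_radical_iff, Ideal.span_le]
    rintro _ ⟨i, rfl⟩
    exact ⟨n + 1, Ideal.subset_span ⟨i, rfl⟩⟩
  have hzm : ∀ i, z i ∈ maximalIdeal R := fun i => by
    rw [hE]; exact mulVec_mem_ideal _ _ _ hxm i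
  obtain ⟨N, hN⟩ := exists_pow_succ_mem fun i => hXrad (hzm i)
  set Z : Fin t → R := fun i => z i ^ (N + 1) with hZ
  obtain ⟨F, hF⟩ := exists_mulVec_of_mem_span X Z hN
  have hZz := pow_succ_eq_diagonal_mulVec z N
  let K : Ideal R := Submodule.comap (LinearMap.mulLeft R F.det) (limitClosure Z)
  have hK : ∀ a, a ∈ K ↔ F.det * a ∈ limitClosure Z := fun a => Iff.rfl
  -- Injectivity of X → Z need only be tested on socle elements. Modulo (X) these are c (∏ x_i)^n;
  -- comparing the two factorisations of x → Z turns the condition on such an element into det E · c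
  -- ∈ (z)^lim, to which `H` applies.
  have hKle : K ≤ Ideal.span (Set.range X) := by
    by_contra hnot
    obtain ⟨a, haK, haX, hsoc⟩ := exists_socle_element hXrad hnot
    obtain ⟨c, hc⟩ := hx.exists_sub_mul_prod_mem n fun i => hsoc _ (hxm i)
    have h1 : F.det * (c * (∏ i, x i) ^ n) ∈ limitClosure Z := by
      have h2 := det_mul_mem_limitClosure hF (span_le_limitClosure X hc)
      convert sub_mem ((hK a).1 haK) h2 using 1
      ring
    have e1 : Z = (F * Matrix.diagonal fun i => x i ^ n) *ᵥ x := by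
      rw [← Matrix.mulVec_mulVec, ← pow_succ_eq_diagonal_mulVec]
      exact hF
    have e2 : Z = (Matrix.diagonal (fun i => z i ^ N) * E) *ᵥ x := by
      rw [← Matrix.mulVec_mulVec, ← hE]
      exact hZz
    have h3 := det_sub_det_mem_limitClosure e1 e2
    simp only [Matrix.det_mul, Matrix.det_diagonal, Finset.prod_pow] at h3
    have h4 : (∏ i, z i) ^ N * (E.det * c) ∈ limitClosure Z := by
      convert sub_mem h1 (Ideal.mul_mem_left _ c h3) using 1
      ring
    have h5 := H c (mem_limitClosure_of_prod_pow_mul_mem h4)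
    have h6 := mul_prod_pow_mem x 1 n (a := c) (by simpa using h5)
    rw [add_comm 1 n] at h6
    apply haX
    convert add_mem hc h6 using 1
    ring
  have e1 : Z = (F * B) *ᵥ v := by
    rw [← Matrix.mulVec_mulVec, ← hB]
    exact hF
  have e2 : Z = (Matrix.diagonal (fun i => z i ^ N) * G) *ᵥ v := by
    rw [← Matrix.mulVec_mulVec, ← hG]
    exact hZz
  have h3 := det_sub_det_mem_limitClosure e1 e2
  simp only [Matrix.det_mul, Matrix.det_diagonal, Finset.prod_pow] at h3
  have h4 : B.det * b ∈ K := by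
    rw [hK]
    convert add_mem (prod_pow_mul_mem_limitClosure_pow N hb) (Ideal.mul_mem_left _ b h3) using 1
    ring
  exact hv.limitClosure_le (mem_limitClosure_of_det_mul_mem hB (fun i => hXrad (hvm i))
    (span_le_limitClosure X (hKle h4)))

/-- A regular sequence of length `g` in a Cohen–Macaulay ring of dimension `g + d` can be completed
to a regular sequence of length `g + d` not capturing a given element. -/
theorem DepthAtLeast.exists_isPermutableRegular_append {g d : ℕ}
    (h : DepthAtLeast (d + g) (⊥ : Ideal R))
    {z : Fin g → R} (hzm : ∀ i, z i ∈ maximalIdeal R) (hz : IsRegularSeqMod ⊥ (List.ofFn z))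
    {b : R} (hb : b ∉ Ideal.span (Set.range z)) :
    ∃ w : Fin d → R, (∀ i, w i ∈ maximalIdeal R) ∧ IsPermutableRegular (Fin.append z w) ∧
      b ∉ Ideal.span (Set.range (Fin.append z w)) := by
  have hzm' : ∀ a ∈ List.ofFn z, a ∈ maximalIdeal R := by
    intro a ha
    obtain ⟨i, rfl⟩ := (List.mem_ofFn' z a).1 ha
    exact hzm i
  have h1 : DepthAtLeast d (⊥ ⊔ Ideal.ofList (List.ofFn z)) :=
    DepthAtLeast.sup_ofList (by simpa using h) hzm' hz
  obtain ⟨l, rfl, hlm, hl⟩ := h1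
  let u : Fin l.length → R := l.get
  have hu : ∀ i, u i ∈ maximalIdeal R := fun i => hlm _ (List.get_mem l i)
  have hreg : IsPermutableRegular (Fin.append z u) := by
    refine IsRegularSeqMod.isPermutableRegular ?_ ?_
    · intro i
      refine Fin.addCases (fun j => ?_) (fun j => ?_) i
      · simpa using hzm j
      · simpa using hu j
    · rw [List.ofFn_fin_append, IsRegularSeqMod.append, List.ofFn_get]
      exact ⟨hz, hl⟩
  obtain ⟨k, hk⟩ := exists_notMem_sup_maximalIdeal_pow hb
  -- The completing elements are pushed into 𝔪^k, so they cannot bring b into the ideal.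
  refine ⟨fun i => u i ^ (k + 1), fun i => Ideal.pow_mem_of_mem _ (hu i) _ k.succ_pos, ?_, ?_⟩
  · convert hreg.pow (Fin.append (fun _ => 1) fun _ => k + 1) using 1
    ext i
    refine Fin.addCases (fun j => ?_) (fun j => ?_) i <;> simp
  · intro hmem
    refine hk (Ideal.span_le.2 ?_ hmem)
    rintro _ ⟨i, rfl⟩
    refine Fin.addCases (fun j => ?_) (fun j => ?_) i
    · rw [Fin.append_left]
      exact Ideal.mem_sup_left (Ideal.subset_span ⟨j, rfl⟩)
    · rw [Fin.append_right]
      exact Ideal.mem_sup_right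
        (Ideal.pow_le_pow_right k.le_succ (Ideal.pow_mem_pow (hu j) (k + 1)))

/-- In a Cohen–Macaulay ring, a determinantal map from a system of parameters is injective only
if its target is a system of parameters. -/
theorem DepthAtLeast.maximalIdeal_le_radical_of_injective {t : ℕ}
    (hdepth : DepthAtLeast t (⊥ : Ideal R)) (hdim : ringKrullDim R ≤ t) {x y : Fin t → R}
    {A : Matrix (Fin t) (Fin t) R} (hA : y = A *ᵥ x) (hxm : ∀ i, x i ∈ maximalIdeal R)
    (hxrad : maximalIdeal R ≤ (Ideal.span (Set.range x)).radical)
    (H : ∀ a, A.det * a ∈ limitClosure y → a ∈ limitClosure x) :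
    maximalIdeal R ≤ (Ideal.span (Set.range y)).radical := by
  classical
  have hx : IsPermutableRegular x := by
    refine IsRegularSeqMod.isPermutableRegular hxm (DepthAtLeast.isRegularSeqMod (by simpa) ?_ ?_)
    · intro a ha
      obtain ⟨i, rfl⟩ := (List.mem_ofFn' x a).1 ha
      exact hxm i
    · simpa [ofList_ofFn] using hxrad
  set I := Ideal.span (Set.range y) with hI
  have hym : ∀ i, y i ∈ maximalIdeal R := fun i => by
    rw [hA]; exact mulVec_mem_ideal _ _ _ hxm i
  have hIm : I ≤ maximalIdeal R := by
    rw [hI, Ideal.span_le]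
    rintro _ ⟨i, rfl⟩
    exact hym i
  obtain ⟨z, hzI, hz⟩ := exists_generic_sequence I
  have hreg : ∀ i, (∀ p ∈ Submodule.associatedPrimes (Ideal.span (z '' Set.Iio i)), ¬ I ≤ p) →
      IsRegularMod (Ideal.span (z '' Set.Iio i)) (z i) := fun i hi =>
    isRegularMod_iff.2 fun p hp hzp => hi p hp (hz i p hp hzp)
  by_cases hall : ∀ i < t, ∀ p ∈ Submodule.associatedPrimes (Ideal.span (z '' Set.Iio i)), ¬ I ≤ p
  · refine (maximalIdeal_le_radical_span_of_isRegularMod hdim fun i hi =>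
      hreg i (hall i hi)).trans (Ideal.radical_mono ?_)
    rw [Ideal.span_le]
    rintro _ ⟨i, -, rfl⟩
    exact hzI i
  exfalso
  push Not at hall
  obtain ⟨g, ⟨hgt, P, hP, hIP⟩, hmin⟩ : ∃ g, (g < t ∧
      ∃ p ∈ Submodule.associatedPrimes (Ideal.span (z '' Set.Iio g)), I ≤ p) ∧
      ∀ i < g, ¬ (i < t ∧
        ∃ p ∈ Submodule.associatedPrimes (Ideal.span (z '' Set.Iio i)), I ≤ p) :=
    ⟨Nat.find hall, Nat.find_spec hall, fun i => Nat.find_min hall⟩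
  have hgmin : ∀ i < g, ∀ p ∈ Submodule.associatedPrimes (Ideal.span (z '' Set.Iio i)),
      ¬ I ≤ p := fun i hi p hp hIp => hmin i hi ⟨by omega, p, hp, hIp⟩
  obtain ⟨hPpr, b, hPb⟩ := Ideal.exists_mem_iff_of_mem_associatedPrimes hP
  obtain ⟨d, rfl⟩ := Nat.exists_eq_add_of_le hgt.le
  have hbJ : b ∉ Ideal.span (Set.range fun i : Fin g => z i) := by
    rw [← image_Iio_eq_range]
    intro hb
    exact hPpr.ne_top ((Ideal.eq_top_iff_one P).2 ((hPb 1).2 (by simpa using hb)))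
  obtain ⟨w, hwm, hv, hbv⟩ := DepthAtLeast.exists_isPermutableRegular_append
    (by rwa [add_comm]) (fun i => hIm (hzI i))
    (isRegularSeqMod_ofFn fun i hi => hreg i (hgmin i hi)) hbJ
  set v := Fin.append (fun i : Fin g => z i) w with hvdef
  have hvm : ∀ i, v i ∈ maximalIdeal R := by
    intro i
    refine Fin.addCases (fun j => ?_) (fun j => ?_) i
    · simpa [hvdef] using hIm (hzI j)
    · simpa [hvdef] using hwm j
  have hvrad := hv.maximalIdeal_le_radical hdim
  obtain ⟨L, hL⟩ := exists_pow_succ_mem (x := fun j : Fin d => z (g + j))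
    fun j => hvrad (hIm (hzI _))
  -- The first g entries already belong to v; only the tail needs a power to land in (v).
  set z' : Fin (g + d) → R := Fin.append (fun i : Fin g => z i) (fun j => z (g + j) ^ (L + 1))
    with hz'
  have hz'v : ∀ i, z' i ∈ Ideal.span (Set.range v) := by
    intro i
    refine Fin.addCases (fun j => ?_) (fun j => ?_) i
    · exact Ideal.subset_span ⟨Fin.castAdd d j, by simp [hz', hvdef]⟩
    · simpa [hz'] using hL j
  have hz'I : ∀ i, z' i ∈ I := by
    intro i
    refine Fin.addCases (fun j => ?_) (fun j => ?_) i
    · simpa [hz'] using hzI j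
    · simpa [hz'] using Ideal.pow_mem_of_mem _ (hzI (g + j)) _ L.succ_pos
  obtain ⟨G, hG⟩ := exists_mulVec_of_mem_span v z' hz'v
  obtain ⟨C, hC⟩ := exists_mulVec_of_mem_span y z' hz'I
  have hIz' : I ≤ (Ideal.span (Set.range z')).radical := by
    refine (le_radical_span_image_Iio hIm hdim fun i _ p hp hzp =>
      hz i p (Ideal.minimalPrimes_subset_associatedPrimes _ hp) hzp).trans ?_
    rw [Ideal.radical_le_radical_iff, image_Iio_eq_range, Ideal.span_le]
    rintro _ ⟨i, rfl⟩
    refine Fin.addCases (fun j => ?_) (fun j => ?_) i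
    · exact Ideal.le_radical (Ideal.subset_span ⟨Fin.castAdd d j, by simp [hz']⟩)
    · exact ⟨L + 1, Ideal.subset_span ⟨Fin.natAdd g j, by simp [hz']⟩⟩
  have hCA : z' = (C * A) *ᵥ x := by rw [← Matrix.mulVec_mulVec, ← hA]; exact hC
  have hbz' : b ∈ limitClosure z' := by
    -- Since g < t there is a tail entry, a power of z_g; it lies in I ⊆ P, so it multiplies b into
    -- the ideal of the head.
    refine mem_limitClosure_append ⟨0, by omega⟩ ?_
    rw [← image_Iio_eq_range, mul_comm]
    refine (hPb _).1 (hIP ?_)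
    exact Ideal.pow_mem_of_mem _ (hzI _) _ L.succ_pos
  -- Injectivity along x → z' comes from that of x → y followed by y → z', the latter because I and
  -- (z') have the same radical.
  refine hbv (hv.mem_span_of_det_mul_mem hCA hG hx hxm hvm hxrad hvrad (fun a ha => ?_)
    (Ideal.mul_mem_left _ _ hbz'))
  refine hx.limitClosure_le (H a ?_)
  refine mem_limitClosure_of_det_mul_mem hC (fun i => hIz' (Ideal.subset_span ⟨i, rfl⟩)) ?_
  rwa [Matrix.det_mul, mul_assoc] at ha

end

/-! ### Translation of the definitions, and the unmixed component. -/

section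

variable {R : Type*} [CommRing R]

theorem isRegularSeqMod_of_forall {J : Ideal R} {l : List R}
    (h : ∀ (i : ℕ) (hi : i < l.length), IsRegularMod (J ⊔ Ideal.ofList (l.take i)) l[i]) :
    IsRegularSeqMod J l := by
  induction l generalizing J with
  | nil => trivial
  | cons s l ih =>
    refine ⟨by have := h 0 (by simp); simpa using this, ih fun i hi => ?_⟩
    have := h (i + 1) (by simpa using hi)
    simpa [sup_assoc] using this

theorem RingTheory.Sequence.IsWeaklyRegular.isRegularSeqMod {l : List R}
    (h : RingTheory.Sequence.IsWeaklyRegular R l) : IsRegularSeqMod ⊥ l := by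
  refine isRegularSeqMod_of_forall fun i hi => ?_
  intro a ha
  have h1 := (isSMulRegular_quotient_iff_mem_of_smul_mem _ _).1 (h.regular_mod_prev i hi) a
  simp only [smul_eq_mul, Ideal.mul_top] at h1
  simpa using h1 (by simpa using ha)

theorem determinantalMap_injective_iff {r : ℕ} {x y : Fin r → R} {A : Matrix (Fin r) (Fin r) R}
    (h : y = A *ᵥ x) :
    Function.Injective (determinantalMap x y A h) ↔
      ∀ a, A.det * a ∈ limitClosure y → a ∈ limitClosure x := by
  rw [injective_iff_map_eq_zero]
  have e : ∀ a : R, determinantalMap x y A h (Submodule.Quotient.mk a) =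
      Submodule.Quotient.mk (A.det * a) := fun a => rfl
  constructor
  · intro H a ha
    have := H (Submodule.Quotient.mk a) (by rw [e]; exact (Submodule.Quotient.mk_eq_zero _).2 ha)
    exact (Submodule.Quotient.mk_eq_zero _).1 this
  · intro H a
    obtain ⟨a, rfl⟩ := Submodule.Quotient.mk_surjective _ a
    intro ha
    rw [e] at ha
    exact (Submodule.Quotient.mk_eq_zero _).2 (H a ((Submodule.Quotient.mk_eq_zero _).1 ha))

theorem exists_prime_le_ringKrullDim_quotient {J : Ideal R} {n : ℕ}
    (h : (n : WithBot ℕ∞) ≤ ringKrullDim (R ⧸ J)) :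
    ∃ p : Ideal R, p.IsPrime ∧ J ≤ p ∧ (n : WithBot ℕ∞) ≤ ringKrullDim (R ⧸ p) := by
  rw [ringKrullDim_quotient, Order.le_krullDim_iff] at h
  obtain ⟨l, hl⟩ := h
  refine ⟨l.head.1.asIdeal, l.head.1.2, l.head.2, ?_⟩
  rw [ringKrullDim_quotient, Order.le_krullDim_iff]
  refine ⟨⟨l.length, fun i => ⟨(l i).1, l.head_le i⟩, fun i => l.step i⟩, hl⟩

/-- A prime of maximal dimension is the radical of a component of the primary decomposition of
zero, and the other components are not contained in it. -/
theorem exists_component_of_ringKrullDim_le {T : Finset (Ideal R)}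
    (hT : Submodule.IsMinimalPrimaryDecomposition (⊥ : Ideal R) T) {t : ℕ}
    (ht : ringKrullDim R = t) {p : Ideal R} [hp : p.IsPrime]
    (h : (t : WithBot ℕ∞) ≤ ringKrullDim (R ⧸ p)) :
    ∃ q ∈ T, q.radical = p ∧ ringKrullDim (R ⧸ q.radical) = ringKrullDim R ∧
      ∃ s ∉ p, ∀ q' ∈ T, q' ≠ q → s ∈ q' := by
  classical
  -- A strictly smaller prime would have a quotient of dimension above dim R, so p is minimal.
  have hmin' : ∀ p' : Ideal R, p'.IsPrime → p' ≤ p → p' = p := by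
    intro p' hp' hle
    by_contra hne
    have h1 := ringKrullDim_quotient_add_one_le_of_lt (lt_of_le_of_ne hle hne)
    have h2 := ringKrullDim_quotient_le p'
    rw [ht] at h2
    have h3 : (t : WithBot ℕ∞) + 1 ≤ t := (add_le_add_left h 1).trans (h1.trans h2)
    have h4 : t + 1 ≤ t := by exact_mod_cast h3
    omega
  have hmin : p ∈ (⊥ : Ideal R).minimalPrimes :=
    ⟨⟨hp, bot_le⟩, fun p' hp' hle => (hmin' p' hp'.1 hle).ge⟩
  obtain ⟨q, hq, hqp⟩ := Ideal.IsMinimalPrimaryDecomposition.minimalPrimes_subset_image_radical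
    hT hmin
  refine ⟨q, hq, hqp, ?_, ?_⟩
  · rw [hqp]
    exact le_antisymm (ringKrullDim_quotient_le p) (ht ▸ h)
  · have hnot : ¬ (T.erase q).inf id ≤ p := by
      intro hle
      obtain ⟨q', hq', hle'⟩ := (Ideal.IsPrime.inf_le' hp).1 hle
      obtain ⟨hne, hq'T⟩ := Finset.mem_erase.1 hq'
      have h1 : q'.radical = p := hmin' _ (Ideal.isPrime_radical (hT.primary hq'T))
        ((Ideal.IsPrime.radical_le_iff hp).2 hle')
      refine hT.distinct hq'T hq hne ?_
      change (q'.colon Set.univ).radical = (q.colon Set.univ).radical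
      rw [Submodule.colon_univ, Submodule.colon_univ, h1, hqp]
    obtain ⟨s, hs, hsp⟩ := Set.not_subset.1 hnot
    refine ⟨s, hsp, fun q' hq' hne => ?_⟩
    exact (Submodule.mem_finsetInf.1 hs) q' (Finset.mem_erase.2 ⟨hne, hq'⟩)

theorem mem_topDimensionalPart {T : Finset (Ideal R)} {a : R} :
    a ∈ topDimensionalPart T ↔
      ∀ q ∈ T, ringKrullDim (R ⧸ q.radical) = ringKrullDim R → a ∈ q := by
  simp [topDimensionalPart, Submodule.mem_iInf]

end

section

variable {R : Type*} [CommRing R] [IsLocalRing R]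

open IsLocalRing

theorem maximalIdeal_quotient_le_radical_iff {t : ℕ} {J : Ideal R} [IsLocalRing (R ⧸ J)]
    {x : Fin t → R} :
    maximalIdeal (R ⧸ J) ≤
        (Ideal.span (Set.range fun i => Ideal.Quotient.mk J (x i))).radical ↔
      maximalIdeal R ≤ (Ideal.span (Set.range x) ⊔ J).radical := by
  have e : Ideal.span (Set.range fun i => Ideal.Quotient.mk J (x i)) =
      (Ideal.span (Set.range x)).map (Ideal.Quotient.mk J) := by
    rw [Ideal.map_span, ← Set.range_comp]
    rfl
  rw [← map_maximalIdeal_of_surjective _ (Ideal.Quotient.mk_surjective (I := J)), e,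
    Ideal.map_le_iff_le_comap, Ideal.comap_radical,
    Ideal.comap_map_of_surjective _ Ideal.Quotient.mk_surjective, ← RingHom.ker_eq_comap_bot,
    Ideal.mk_ker]

theorem IsCohenMacaulayModule.depthAtLeast {t : ℕ} {J : Ideal R} [IsLocalRing (R ⧸ J)]
    (h : IsCohenMacaulayModule R (R ⧸ J)) (ht : ringKrullDim (R ⧸ J) = t) :
    DepthAtLeast t (⊥ : Ideal (R ⧸ J)) := by
  obtain h | ⟨l, hlm, hl, hdim⟩ := h
  · exact absurd h (not_subsingleton _)
  rw [Module.supportDim_quotient_eq_ringKrullDim, ht] at hdim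
  have hlen : t = l.length := by exact_mod_cast hdim
  refine ⟨l.map (algebraMap R (R ⧸ J)), by simp [hlen], ?_, ?_⟩
  · intro a ha
    obtain ⟨b, hb, rfl⟩ := List.mem_map.1 ha
    rw [← map_maximalIdeal_of_surjective _ (Ideal.Quotient.mk_surjective (I := J))]
    exact Ideal.mem_map_of_mem _ (hlm b hb)
  · exact ((RingTheory.Sequence.isWeaklyRegular_map_algebraMap_iff (R ⧸ J) (R ⧸ J) l).2
      hl.toIsWeaklyRegular).isRegularSeqMod

theorem ringKrullDim_quotient_maximalIdeal : ringKrullDim (R ⧸ maximalIdeal R) = 0 :=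
  ringKrullDim_eq_zero_of_isField
    ((Ideal.Quotient.maximal_ideal_iff_isField_quotient _).1 (maximalIdeal.isMaximal R))

end

section

variable {R : Type*} [CommRing R] [IsNoetherianRing R]

theorem unmixedComponent_le {t : ℕ} (ht : ringKrullDim R = t) {p : Ideal R} [p.IsPrime]
    (h : (t : WithBot ℕ∞) ≤ ringKrullDim (R ⧸ p)) : unmixedComponent R ≤ p := by
  obtain ⟨T, hT⟩ := exists_reducedPrimaryDecomposition R
  obtain ⟨q, hq, hqp, hd, -⟩ := exists_component_of_ringKrullDim_le hT ht h
  rw [unmixedComponent_eq R hT]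
  intro a ha
  exact hqp ▸ Ideal.le_radical (mem_topDimensionalPart.1 ha q hq hd)

/-- Otherwise a prime p of full dimension contains ann(u). An element s outside p lying in every
component except the one at p satisfies s u = 0, because u lies in that one; so s is in ann(u) ⊆ p.
-/
theorem ringKrullDim_quotient_colon_lt {t : ℕ} (ht : ringKrullDim R = t) {u : R}
    (hu : u ∈ unmixedComponent R) : ringKrullDim (R ⧸ (⊥ : Ideal R).colon {u}) < t := by
  classical
  by_contra! h
  obtain ⟨p, hp, hle, hd⟩ := exists_prime_le_ringKrullDim_quotient h
  obtain ⟨T, hT⟩ := exists_reducedPrimaryDecomposition R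
  obtain ⟨q, hq, hqp, hdq, s, hsp, hs⟩ := exists_component_of_ringKrullDim_le hT ht hd
  rw [unmixedComponent_eq R hT] at hu
  refine hsp (hle ?_)
  rw [Submodule.mem_colon_singleton, ← hT.inf_eq, Submodule.mem_finsetInf]
  intro q' hq'
  by_cases hne : q' = q
  · subst hne
    exact Ideal.mul_mem_left _ _ (mem_topDimensionalPart.1 hu q' hq hdq)
  · exact Ideal.mul_mem_right _ _ (hs q' hq' hne)

theorem ringKrullDim_quotient_unmixedComponent {t : ℕ} (ht : ringKrullDim R = t) :
    ringKrullDim (R ⧸ unmixedComponent R) = t := by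
  refine le_antisymm (ht ▸ ringKrullDim_quotient_le _) ?_
  obtain ⟨p, hp, -, hd⟩ := exists_prime_le_ringKrullDim_quotient (J := (⊥ : Ideal R)) (n := t) (by
    rw [ringKrullDim_eq_of_ringEquiv (RingEquiv.quotientBot R), ht])
  exact hd.trans (ringKrullDim_le_of_surjective _
    (Ideal.Quotient.factor_surjective (unmixedComponent_le ht hd)))

end

/-! ### Systems of parameters and reduction modulo the unmixed component. -/

section

variable {R : Type*} [CommRing R] [IsLocalRing R] [IsNoetherianRing R]

open IsLocalRing

theorem isFiniteLength_quotient_iff {Q : Ideal R} :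
    IsFiniteLength R (R ⧸ Q) ↔ maximalIdeal R ≤ Q.radical := by
  rw [isFiniteLength_iff_isNoetherian_isArtinian]
  constructor
  · rintro ⟨-, hart⟩
    rw [Ideal.radical_eq_sInf]
    refine le_sInf ?_
    rintro P ⟨hQP, hP⟩
    have h1 : IsArtinian R (R ⧸ P) := isArtinian_of_surjective (R ⧸ Q) (Submodule.factor hQP)
      (Submodule.factor_surjective hQP)
    have h2 : IsArtinianRing (R ⧸ P) := isArtinian_of_tower R h1
    have h3 := IsArtinianRing.isField_of_isDomain (R ⧸ P)
    exact (eq_maximalIdeal (Ideal.Quotient.maximal_of_isField P h3)).ge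
  · intro h
    refine ⟨inferInstance, ?_⟩
    by_cases hQ : Q = ⊤
    · subst hQ
      infer_instance
    have : Nontrivial (R ⧸ Q) := Ideal.Quotient.nontrivial_iff.2 hQ
    have hloc : IsLocalRing (R ⧸ Q) :=
      IsLocalRing.of_surjective' (Ideal.Quotient.mk Q) Ideal.Quotient.mk_surjective
    have : IsArtinianRing (R ⧸ Q) := by
      rw [isArtinianRing_iff_isNilpotent_maximalIdeal]
      obtain ⟨n, hn⟩ := Ideal.exists_pow_le_of_le_radical_of_fg h (IsNoetherian.noetherian _)
      refine ⟨n, ?_⟩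
      rw [← map_maximalIdeal_of_surjective _ (Ideal.Quotient.mk_surjective (I := Q)),
        ← Ideal.map_pow, Ideal.zero_eq_bot, Ideal.map_eq_bot_iff_le_ker, Ideal.mk_ker]
      exact hn
    exact isArtinian_of_surjective_algebraMap (Ideal.Quotient.mk_surjective (I := Q))

theorem isFiniteLength_quotient_quotient_iff {J K : Ideal R} :
    IsFiniteLength R ((R ⧸ J) ⧸ (K • ⊤ : Submodule R (R ⧸ J))) ↔
      maximalIdeal R ≤ (K ⊔ J).radical := by
  rw [← isFiniteLength_quotient_iff]
  let f : R →ₗ[R] (R ⧸ J) ⧸ (K • ⊤ : Submodule R (R ⧸ J)) :=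
    (K • ⊤ : Submodule R (R ⧸ J)).mkQ ∘ₗ Submodule.mkQ J
  have hf : Function.Surjective f :=
    (Submodule.mkQ_surjective _).comp (Submodule.mkQ_surjective J)
  have hker : LinearMap.ker f = K ⊔ J := by
    rw [LinearMap.ker_comp, Submodule.ker_mkQ,
      Submodule.comap_smul_top_of_surjective K _ (Submodule.mkQ_surjective J), Submodule.ker_mkQ,
      smul_eq_mul, Ideal.mul_top]
  have e := (Submodule.quotEquivOfEq _ _ hker).symm.trans (f.quotKerEquivOfSurjective hf)
  exact ⟨fun h => e.symm.isFiniteLength h, fun h => e.isFiniteLength h⟩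

theorem isSystemOfParameters_iff {t : ℕ} {x : Fin t → R} :
    IsSystemOfParameters R x ↔ ringKrullDim R = t ∧ (∀ i, x i ∈ maximalIdeal R) ∧
      maximalIdeal R ≤ (Ideal.span (Set.range x)).radical := by
  have h : ∀ K : Ideal R, IsFiniteLength R (R ⧸ (K • ⊤ : Submodule R R)) ↔
      maximalIdeal R ≤ K.radical := fun K => by
    rw [smul_eq_mul, Ideal.mul_top, isFiniteLength_quotient_iff]
  rw [← h, ← Module.supportDim_self_eq_ringKrullDim]
  exact ⟨fun h => ⟨h.1, h.2, h.3⟩, fun h => ⟨h.1, h.2.1, h.2.2⟩⟩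

theorem isSystemOfParameters_quotient_iff {t : ℕ} {J : Ideal R} {x : Fin t → R} :
    IsSystemOfParameters (R ⧸ J) x ↔ ringKrullDim (R ⧸ J) = t ∧ (∀ i, x i ∈ maximalIdeal R) ∧
      maximalIdeal R ≤ (Ideal.span (Set.range x) ⊔ J).radical := by
  rw [← isFiniteLength_quotient_quotient_iff, ← Module.supportDim_quotient_eq_ringKrullDim]
  exact ⟨fun h => ⟨h.1, h.2, h.3⟩, fun h => ⟨h.1, h.2.1, h.2.2⟩⟩

theorem isSystemOfParameters_iff_injective {t : ℕ} {x y : Fin t → R}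
    {A : Matrix (Fin t) (Fin t) R} (hA : y = A *ᵥ x) (hx : IsSystemOfParameters R x)
    [IsLocalRing (R ⧸ unmixedComponent R)]
    (hdepth : DepthAtLeast t (⊥ : Ideal (R ⧸ unmixedComponent R))) :
    IsSystemOfParameters (R ⧸ unmixedComponent R) y ↔
      Function.Injective (determinantalMap x y A hA) := by
  obtain ⟨hdim, hxm, hxrad⟩ := isSystemOfParameters_iff.1 hx
  have hym : ∀ i, y i ∈ maximalIdeal R := fun i => by
    rw [hA]; exact mulVec_mem_ideal _ _ _ hxm i
  have hdimU := ringKrullDim_quotient_unmixedComponent hdim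
  set U := unmixedComponent R with hU
  have hsmall : ∀ u ∈ U, ringKrullDim (R ⧸ (⊥ : Ideal R).colon {u}) < t := fun u hu =>
    ringKrullDim_quotient_colon_lt hdim hu
  set π := Ideal.Quotient.mk U with hπ
  have hA' : (fun i => π (y i)) = A.map π *ᵥ fun i => π (x i) := by
    ext i
    rw [hA]
    exact RingHom.map_mulVec π A x i
  have hdet : ∀ a, (A.map π).det * π a = π (A.det * a) := fun a => by
    rw [map_mul, RingHom.map_det]; rfl
  have hrad : ∀ i, ∀ z : Fin t → R, maximalIdeal R ≤ (Ideal.span (Set.range z) ⊔ U).radical →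
      π (x i) ∈ (Ideal.span (Set.range fun i => π (z i))).radical := fun i z hz =>
    maximalIdeal_quotient_le_radical_iff.2 hz (by
      rw [← map_maximalIdeal_of_surjective π Ideal.Quotient.mk_surjective]
      exact Ideal.mem_map_of_mem _ (hxm i))
  rw [isSystemOfParameters_quotient_iff, determinantalMap_injective_iff]
  simp only [hdimU, hym, implies_true, true_and]
  constructor
  · intro h a ha
    rw [← mk_mem_limitClosure_iff_mem hsmall hxm]
    refine mem_limitClosure_of_det_mul_mem hA' (fun i => hrad i y h) ?_
    rw [hdet]
    exact (mk_mem_limitClosure_iff_mem hsmall hym).2 ha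
  · intro H
    rw [← maximalIdeal_quotient_le_radical_iff]
    refine hdepth.maximalIdeal_le_radical_of_injective hdimU.le hA' (fun i => ?_) ?_ ?_
    · rw [← map_maximalIdeal_of_surjective π Ideal.Quotient.mk_surjective]
      exact Ideal.mem_map_of_mem _ (hxm i)
    · rw [maximalIdeal_quotient_le_radical_iff]
      exact hxrad.trans (Ideal.radical_mono le_sup_left)
    · intro a
      obtain ⟨a, rfl⟩ := Ideal.Quotient.mk_surjective a
      intro ha
      rw [hdet] at ha
      exact (mk_mem_limitClosure_iff_mem hsmall hxm).2
        (H a ((mk_mem_limitClosure_iff_mem hsmall hym).1 ha))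

/-- In dimension one, the maximal ideal is not associated to any top-dimensional component, as its
residue field has dimension zero. Prime avoidance gives an element regular modulo each of them,
hence modulo their intersection. -/
theorem depthAtLeast_one_of_ringKrullDim_eq_one [IsLocalRing (R ⧸ unmixedComponent R)]
    (h : ringKrullDim R = 1) : DepthAtLeast 1 (⊥ : Ideal (R ⧸ unmixedComponent R)) := by
  obtain ⟨T, hT⟩ := exists_reducedPrimaryDecomposition R
  obtain ⟨c, hcm, hc⟩ := exists_isRegularMod_of_maximalIdeal_notMem
    (S := {q | q ∈ T ∧ ringKrullDim (R ⧸ q.radical) = ringKrullDim R})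
    (T.finite_toSet.subset fun q hq => hq.1) (by
      rintro q ⟨hq, hd⟩ hm
      obtain ⟨-, b, hb⟩ := Ideal.exists_mem_iff_of_mem_associatedPrimes hm
      obtain ⟨hne, hprim⟩ := Ideal.isPrimary_iff.1 (hT.primary hq)
      have hbq : b ∉ q := fun hbq => by
        have := (hb 1).2 (by simpa using hbq)
        exact (Ideal.IsPrime.ne_top (I := maximalIdeal R) inferInstance)
          ((Ideal.eq_top_iff_one _).2 this)
      have hle : maximalIdeal R ≤ q.radical := fun s hs =>
        (hprim (x := b) (y := s) (by rw [mul_comm]; exact (hb s).1 hs)).resolve_left hbq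
      have heq : maximalIdeal R = q.radical := (maximalIdeal.isMaximal R).eq_of_le
        (Ideal.isPrime_radical (hT.primary hq)).ne_top hle
      rw [← heq, ringKrullDim_quotient_maximalIdeal, h] at hd
      exact zero_ne_one hd)
  refine depthAtLeast_succ.2 ⟨Ideal.Quotient.mk _ c, ?_, ?_, depthAtLeast_zero _⟩
  · rw [← map_maximalIdeal_of_surjective _
      (Ideal.Quotient.mk_surjective (I := unmixedComponent R))]
    exact Ideal.mem_map_of_mem _ hcm
  · intro a ha
    obtain ⟨a, rfl⟩ := Ideal.Quotient.mk_surjective a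
    rw [← map_mul, Ideal.mem_bot, Ideal.Quotient.eq_zero_iff_mem, unmixedComponent_eq R hT,
      mem_topDimensionalPart] at ha
    rw [Ideal.mem_bot, Ideal.Quotient.eq_zero_iff_mem, unmixedComponent_eq R hT,
      mem_topDimensionalPart]
    exact fun q hq hd => hc q ⟨hq, hd⟩ a (ha q hq hd)

theorem unmixedComponent_le_nilradical_of_ringKrullDim_eq_one (h : ringKrullDim R = 1) :
    unmixedComponent R ≤ nilradical R := by
  have key : ∀ P : Ideal R, P.IsPrime → P < maximalIdeal R → unmixedComponent R ≤ P := by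
    intro P hP hlt
    refine unmixedComponent_le (t := 1) (by simpa using h) ?_
    have := ringKrullDim_quotient_add_one_le_of_lt hlt
    rw [ringKrullDim_quotient_maximalIdeal, zero_add] at this
    simpa using this
  rw [nilradical, Ideal.radical_eq_sInf]
  refine le_sInf ?_
  rintro P ⟨-, hP⟩
  obtain hlt | heq := (le_maximalIdeal hP.ne_top).lt_or_eq
  · exact key P hP hlt
  · rw [heq]
    refine le_maximalIdeal fun htop => ?_
    have h1 := ringKrullDim_quotient_unmixedComponent (R := R) (t := 1) (by simpa using h)
    have : Subsingleton (R ⧸ unmixedComponent R) := Ideal.Quotient.subsingleton_iff.2 htop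
    rw [ringKrullDim_eq_bot_of_subsingleton] at h1
    exact absurd h1 (by simp)

theorem isLocalRing_quotient_unmixedComponent {t : ℕ} (ht : ringKrullDim R = t) :
    IsLocalRing (R ⧸ unmixedComponent R) := by
  have : Nontrivial (R ⧸ unmixedComponent R) := by
    by_contra hn
    rw [not_nontrivial_iff_subsingleton] at hn
    have h1 := ringKrullDim_quotient_unmixedComponent ht
    rw [ringKrullDim_eq_bot_of_subsingleton] at h1
    exact absurd h1 (by simp)
  exact IsLocalRing.of_surjective' (Ideal.Quotient.mk _) Ideal.Quotient.mk_surjective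

end

theorem theorem5p1 (R : Type*) [CommRing R] [IsLocalRing R] [IsNoetherianRing R] :
    (IsCohenMacaulayModule R (R ⧸ unmixedComponent R) →
      ∀ (t : ℕ) (x y : Fin t → R) (A : Matrix (Fin t) (Fin t) R) (hA : y = A *ᵥ x),
        IsSystemOfParameters R x →
          (IsSystemOfParameters (R ⧸ unmixedComponent R) y ↔
            Function.Injective (determinantalMap x y A hA))) ∧
    (ringKrullDim R = 1 →
      ∀ u x : R, IsSystemOfParameters R ![x] →
        (IsSystemOfParameters R ![u * x] ↔
          Function.Injective
            (determinantalMap ![x] ![u * x] !![u] (singleton_eq_mulVec u x)))) := by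
  constructor
  · intro hCM t x y A hA hx
    have hdim := (isSystemOfParameters_iff.1 hx).1
    have := isLocalRing_quotient_unmixedComponent hdim
    exact isSystemOfParameters_iff_injective hA hx
      (hCM.depthAtLeast (ringKrullDim_quotient_unmixedComponent hdim))
  · intro h u x hx
    have hdim := (isSystemOfParameters_iff.1 hx).1
    have := isLocalRing_quotient_unmixedComponent hdim
    rw [← isSystemOfParameters_iff_injective (singleton_eq_mulVec u x) hx
      (depthAtLeast_one_of_ringKrullDim_eq_one h), isSystemOfParameters_iff,
      isSystemOfParameters_quotient_iff, hdim, ringKrullDim_quotient_unmixedComponent hdim]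
    -- The unmixed component is nil in dimension one, so being a parameter of R or of the quotient
    -- is the same condition.
    have e : (Ideal.span (Set.range ![u * x]) ⊔ unmixedComponent R).radical =
        (Ideal.span (Set.range ![u * x])).radical := by
      refine le_antisymm (Ideal.radical_le_radical_iff.2 (sup_le Ideal.le_radical ?_))
        (Ideal.radical_mono le_sup_left)
      exact (unmixedComponent_le_nilradical_of_ringKrullDim_eq_one h).trans
        (Ideal.radical_mono bot_le)
    rw [e]
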